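/- Let $k$ be a commutative ring and $R$ a commutative $k$-algebra; write $\otimes=\otimes_k$. By an $R$-bimodule we mean one on which $k$ acts centrally, i.e. an $R\otimes R$-module, with $(x\otimes y)m=x\cdot m\cdot y$. For $R$-bimodules $M,N$ let $M\bullet N=M\otimes N/\{m\cdot r\otimes n-m\otimes r\cdot n\}$ (a bimodule via the left action on $M$ and the right action on $N$; its unit is $J=R$) and $M\circ N=M\otimes_{R\otimes R}N$ (its unit is $I=R\otimes R$), with interchange law $(M\bullet N)\circ(M'\bullet N')\to(M\circ M')\bullet(N\circ N')$, $(m\bullet n)\circ(m'\bullet n')\mapsto(m\circ m')\bullet(n\circ n')$. Let $\mathsf{bim}(R)$ be the resulting duoidal category. Let $A$ be an $R$-bialgebroid whose unit $\eta:R\otimes R\to A$ takes values in the center of $A$, i.e. a bimonoid in $\mathsf{bim}(R)$. Explicitly: $A$ is a $k$-algebra with $k$-algebra homomorphisms $s=\eta(-\otimes 1)$, $t=\eta(1\otimes -)$ from $R$ to the center of $A$; with the bimodule structure $r\cdot a=s(r)a$, $a\cdot r=t(r)a$ it carries bimodule maps $\Delta:A\to A\bullet A$, $a\mapsto a_1\bullet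 a_2$ (coassociative) and $\varepsilon:A\to R$ (a counit for $\Delta$); and $\Delta$, $\varepsilon$ are multiplicative and unital. A right $A$-comodule is an $R$-bimodule $Q$ with a coassociative and counital bimodule map $Q\to Q\bullet A$, $q\mapsto q_0\bullet q_1$; morphisms are the bimodule maps compatible with the coactions. An $A$-Hopf module is a right $A$-module $M$ that is also a right $A$-comodule with respect to the bimodule structure $r\cdot m=m\,s(r)$, $m\cdot r=m\,t(r)$, such that $(ma)_0\bullet(ma)_1=m_0a_1\bullet m_1a_2$ for all $m\in M$, $a\in A$; morphisms are the $A$-module maps compatible with the coactions. Then the following assertions are equivalent. (i) $A$ is a Hopf algebroid (via the given left bialgebroid structure and the right bialgebroid structure obtained by interchanging the roles of $s$ and $t$); that is, there is an antipode: a $k$-module map $S:A\to A$ such that for all $a\in A$, $r\in R$ $$S(a\,s(r))=t(r)S(a),\quad S(t(r)\,a)=S(a)s(r),\quad a_1S(a_2)=s(\varepsilon(a)),\quad S(a_1)a_2=t(\varepsilon(a)).$$ (ii) The natural transformation $\varsigma$ with components $$\varsigma_Q:Q\circ A\to(Q\circ J)\bullet A,\qquad q\circ a\mapsto(q_0\circ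 1_R)\bullet q_1a,$$ for right $A$-comodules $Q$, is an isomorphism. (iii) The comparison functor $N\mapsto N\bullet A$ from the category of $R$-modules (regarded as $R$-bimodules whose left and right actions coincide) to the category of $A$-Hopf modules is an equivalence, where $N\bullet A$ has the $A$-action $(n\bullet b)a=n\bullet ba$ and the coaction $n\bullet a\mapsto(n\bullet a_1)\bullet a_2$. -/

import Mathlib

open scoped TensorProduct
universe u v

noncomputable section

namespace Bimod

open CategoryTheory MulOpposite

variable (k : Type v) (R : Type u) [CommRing k] [CommRing R] [Algebra k R]

/-- The enveloping algebra `R ⊗ R` of the commutative `k`-algebra `R`.  An `R`-bimodule (with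
`k` acting centrally) is a module over `Env k R`: `(x ⊗ y) • m` is `x · m · y`.  The monoidal
product `∘` of bimodules is the tensor product `M ⊗[Env k R] N`, with unit `I = Env k R`. -/
abbrev Env : Type u := R ⊗[k] R

/-- The left `R`-action `r · m = (r ⊗ 1) • m` of a bimodule. -/
abbrev leftModule (M : Type u) [AddCommGroup M] [Module (Env k R) M] : Module R M :=
  Module.compHom M (Algebra.TensorProduct.includeLeft : R →ₐ[k] Env k R).toRingHom

/-- The right `R`-action `m · r = (1 ⊗ r) • m` of a bimodule. -/
abbrev rightModule (M : Type u) [AddCommGroup M] [Module (Env k R) M] : Module R M :=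
  Module.compHom M (Algebra.TensorProduct.includeRight : R →ₐ[k] Env k R).toRingHom

section BTensor

variable (M N P M₂ N₂ : Type u) [AddCommGroup M] [AddCommGroup N] [AddCommGroup P]
  [AddCommGroup M₂] [AddCommGroup N₂] [Module (Env k R) M] [Module (Env k R) N]
  [Module (Env k R) P] [Module (Env k R) M₂] [Module (Env k R) N₂]

/-- The bimodule tensor product `M • N`: the tensor product over `R` of `M` as a right module
and `N` as a left module. -/
def BTensor : Type u :=
  @TensorProduct R _ M N _ _ (rightModule k R M) (leftModule k R N)

instance : AddCommGroup (BTensor k R M N) :=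
  @TensorProduct.addCommGroup R _ M N _ _ (rightModule k R M) (leftModule k R N)

variable {M N P M₂ N₂}

/-- The class of `m ⊗ n` in `M • N`. -/
def btmul (m : M) (n : N) : BTensor k R M N :=
  @TensorProduct.tmul R _ M N _ _ (rightModule k R M) (leftModule k R N) m n

theorem btmul_add (m : M) (n₁ n₂ : N) :
    btmul k R m (n₁ + n₂) = btmul k R m n₁ + btmul k R m n₂ :=
  @TensorProduct.tmul_add R _ M N _ _ (rightModule k R M) (leftModule k R N) m n₁ n₂

theorem add_btmul (m₁ m₂ : M) (n : N) :
    btmul k R (m₁ + m₂) n = btmul k R m₁ n + btmul k R m₂ n :=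
  @TensorProduct.add_tmul R _ M N _ _ (rightModule k R M) (leftModule k R N) m₁ m₂ n

theorem btmul_balanced (r : R) (m : M) (n : N) :
    btmul k R (((1 : R) ⊗ₜ[k] r) • m) n = btmul k R m ((r ⊗ₜ[k] (1 : R)) • n) :=
  by
  let := rightModule k R M
  let := leftModule k R N
  exact TensorProduct.smul_tmul (R := R) r m n

variable {k R} in
theorem btensor_induction {motive : BTensor k R M N → Prop} (x : BTensor k R M N)
    (zero : motive 0) (tmul : ∀ m n, motive (btmul k R m n))
    (add : ∀ x y, motive x → motive y → motive (x + y)) : motive x :=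
  @TensorProduct.induction_on R _ M N _ _ (rightModule k R M) (leftModule k R N) motive x
    zero tmul add

variable {k R} in
/-- A biadditive map that is `R`-balanced induces an additive map on `M • N`. -/
def bliftAdd {P : Type u} [AddCommGroup P] (f : M →+ N →+ P)
    (hf : ∀ (r : R) (m : M) (n : N),
      f (((1 : R) ⊗ₜ[k] r) • m) n = f m ((r ⊗ₜ[k] (1 : R)) • n)) :
    BTensor k R M N →+ P :=
  @TensorProduct.liftAddHom R _ M N P _ _ _ (rightModule k R M) (leftModule k R N) f hf

theorem bliftAdd_btmul {P : Type u} [AddCommGroup P] (f : M →+ N →+ P)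
    (hf : ∀ (r : R) (m : M) (n : N),
      f (((1 : R) ⊗ₜ[k] r) • m) n = f m ((r ⊗ₜ[k] (1 : R)) • n)) (m : M) (n : N) :
    bliftAdd f hf (btmul k R m n) = f m n := rfl

theorem bt_addHom_ext {P : Type u} [AddCommGroup P] {f g : BTensor k R M N →+ P}
    (h : ∀ m n, f (btmul k R m n) = g (btmul k R m n)) : f = g := by
  ext x
  induction x using btensor_induction with
  | zero => simp
  | tmul m n => exact h m n
  | add x y hx hy => simp [hx, hy]


/-- The additive map `f • g`, for additive maps compatible with the inner `R`-actions. -/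
def bmapAdd (f : M →+ M₂) (g : N →+ N₂)
    (hf : ∀ (r : R) (m : M), f (((1 : R) ⊗ₜ[k] r) • m) = ((1 : R) ⊗ₜ[k] r) • f m)
    (hg : ∀ (r : R) (n : N), g ((r ⊗ₜ[k] (1 : R)) • n) = (r ⊗ₜ[k] (1 : R)) • g n) :
    BTensor k R M N →+ BTensor k R M₂ N₂ :=
  bliftAdd (AddMonoidHom.mk' (fun m => AddMonoidHom.mk' (fun n => btmul k R (f m) (g n))
    (fun a b => by simp [btmul_add])) (fun a b => by ext n; simp [add_btmul]))
    (fun r m n => by simp [hf, hg, btmul_balanced])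

variable (M N) in
/-- The additive endomorphism `m • n ↦ (x · m) • (n · y)`. -/
def outerAct (x y : R) : BTensor k R M N →+ BTensor k R M N :=
  bmapAdd k R (DistribSMul.toAddMonoidHom M (x ⊗ₜ[k] (1 : R)))
    (DistribSMul.toAddMonoidHom N ((1 : R) ⊗ₜ[k] y))
    (fun r m => by simp [smul_smul]) (fun r n => by simp [smul_smul])

theorem outerAct_btmul (x y : R) (m : M) (n : N) :
    outerAct k R M N x y (btmul k R m n)
      = btmul k R ((x ⊗ₜ[k] (1 : R)) • m) (((1 : R) ⊗ₜ[k] y) • n) := rfl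

variable (M N) in
/-- The action of `Env k R` on `M • N`: left action on the left factor, right action on the
right factor. -/
def outerHom : Env k R →+ BTensor k R M N →+ BTensor k R M N :=
  TensorProduct.liftAddHom (R := k)
    (AddMonoidHom.mk' (fun x => AddMonoidHom.mk' (fun y => outerAct k R M N x y)
      (fun a b => bt_addHom_ext k R fun m n => by
        simp [outerAct_btmul, TensorProduct.tmul_add, add_smul, btmul_add]))
      (fun a b => AddMonoidHom.ext fun y => bt_addHom_ext k R fun m n => by
        simp [outerAct_btmul, TensorProduct.add_tmul, add_smul, add_btmul]))
    (fun c x y => bt_addHom_ext k R fun m n => by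
      have h1 : ((c • x) ⊗ₜ[k] (1 : R)) • m
          = ((1 : R) ⊗ₜ[k] algebraMap k R c) • (x ⊗ₜ[k] (1 : R)) • m := by
        rw [smul_smul, Algebra.TensorProduct.tmul_mul_tmul, one_mul, mul_one,
          TensorProduct.smul_tmul, Algebra.algebraMap_eq_smul_one]
      have h2 : ((1 : R) ⊗ₜ[k] (c • y)) • n
          = (algebraMap k R c ⊗ₜ[k] (1 : R)) • ((1 : R) ⊗ₜ[k] y) • n := by
        rw [smul_smul, Algebra.TensorProduct.tmul_mul_tmul, one_mul, mul_one,
          Algebra.algebraMap_eq_smul_one, TensorProduct.smul_tmul]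
      simp only [AddMonoidHom.mk'_apply, outerAct_btmul]
      rw [h1, h2, btmul_balanced])

theorem outerHom_tmul (x y : R) : outerHom k R M N (x ⊗ₜ[k] y) = outerAct k R M N x y := by
  rfl

instance : Module (Env k R) (BTensor k R M N) where
  smul e x := outerHom k R M N e x
  one_smul x := by
    change outerHom k R M N ((1 : R) ⊗ₜ[k] (1 : R)) x = x
    rw [outerHom_tmul]
    induction x using btensor_induction with
    | zero => simp
    | tmul m n => simp [outerAct_btmul, ← Algebra.TensorProduct.one_def]
    | add x y hx hy => simp [hx, hy]
  mul_smul e e₂ x := by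
    change outerHom k R M N (e * e₂) x = outerHom k R M N e (outerHom k R M N e₂ x)
    induction e using TensorProduct.induction_on with
    | zero => simp
    | add a b ha hb => rw [add_mul, map_add, map_add, AddMonoidHom.add_apply, ha, hb]; rfl
    | tmul a b =>
      induction e₂ using TensorProduct.induction_on with
      | zero => simp
      | add c d hc hd => rw [mul_add, map_add, map_add, AddMonoidHom.add_apply, hc, hd,
          AddMonoidHom.add_apply, map_add]
      | tmul c d =>
        rw [Algebra.TensorProduct.tmul_mul_tmul, outerHom_tmul, outerHom_tmul, outerHom_tmul]
        induction x using btensor_induction with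
        | zero => simp
        | tmul m n => simp [outerAct_btmul, smul_smul]
        | add x y hx hy => simp [hx, hy]
  smul_zero e := map_zero _
  smul_add e := map_add _
  add_smul a b x := by
    change outerHom k R M N (a + b) x = outerHom k R M N a x + outerHom k R M N b x
    rw [map_add]; rfl
  zero_smul x := by
    change outerHom k R M N 0 x = 0
    rw [map_zero]; rfl

theorem smul_btmul (x y : R) (m : M) (n : N) :
    (x ⊗ₜ[k] y) • btmul k R m n
      = btmul k R ((x ⊗ₜ[k] (1 : R)) • m) (((1 : R) ⊗ₜ[k] y) • n) := rfl

variable {k R} in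
/-- An additive map compatible with the left and the right `R`-actions is a bimodule map. -/
def linOfAdd (f : M →+ N)
    (hl : ∀ (r : R) (m : M), f ((r ⊗ₜ[k] (1 : R)) • m) = (r ⊗ₜ[k] (1 : R)) • f m)
    (hr : ∀ (r : R) (m : M), f (((1 : R) ⊗ₜ[k] r) • m) = ((1 : R) ⊗ₜ[k] r) • f m) :
    M →ₗ[Env k R] N where
  toFun := f
  map_add' := map_add f
  map_smul' e m := by
    simp only [RingHom.id_apply]
    induction e using TensorProduct.induction_on with
    | zero => simp
    | add a b ha hb => simp [add_smul, ha, hb]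
    | tmul x y =>
      have h : x ⊗ₜ[k] y = (x ⊗ₜ[k] (1 : R)) * ((1 : R) ⊗ₜ[k] y) := by simp
      rw [h, mul_smul, mul_smul, hl, hr]

theorem linOfAdd_apply (f : M →+ N) (hl) (hr) (m : M) :
    linOfAdd (k := k) (R := R) f hl hr m = f m := rfl

variable {k R} in
/-- A biadditive map `f` on `M × N` with `f (m · r, n) = f (m, r · n)`,
`f (r · m, n) = r · f (m, n)` and `f (m, n · r) = f (m, n) · r` induces a bimodule map on
`M • N`. -/
def blift (f : M →+ N →+ P)
    (hf : ∀ (r : R) (m : M) (n : N),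
      f (((1 : R) ⊗ₜ[k] r) • m) n = f m ((r ⊗ₜ[k] (1 : R)) • n))
    (hl : ∀ (r : R) (m : M) (n : N),
      f ((r ⊗ₜ[k] (1 : R)) • m) n = (r ⊗ₜ[k] (1 : R)) • f m n)
    (hr : ∀ (r : R) (m : M) (n : N),
      f m (((1 : R) ⊗ₜ[k] r) • n) = ((1 : R) ⊗ₜ[k] r) • f m n) :
    BTensor k R M N →ₗ[Env k R] P :=
  linOfAdd (bliftAdd f hf)
    (fun r x => by
      induction x using btensor_induction with
      | zero => simp
      | tmul m n =>
        rw [smul_btmul, bliftAdd_btmul, bliftAdd_btmul, hl, ← Algebra.TensorProduct.one_def,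
          one_smul]
      | add x y hx hy => simp [hx, hy])
    (fun r x => by
      induction x using btensor_induction with
      | zero => simp
      | tmul m n =>
        rw [smul_btmul, bliftAdd_btmul, bliftAdd_btmul, hr, ← Algebra.TensorProduct.one_def,
          one_smul]
      | add x y hx hy => simp [hx, hy])

theorem blift_btmul (f : M →+ N →+ P) (hf) (hl) (hr) (m : M) (n : N) :
    blift (k := k) (R := R) f hf hl hr (btmul k R m n) = f m n := rfl

variable {k R} in
theorem bt_hom_ext {f g : BTensor k R M N →ₗ[Env k R] P}
    (h : ∀ m n, f (btmul k R m n) = g (btmul k R m n)) : f = g := by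
  ext x
  induction x using btensor_induction with
  | zero => simp
  | tmul m n => exact h m n
  | add x y hx hy => simp [hx, hy]

variable (M N) in
/-- The biadditive map `(m, n) ↦ m • n`. -/
def btmulHom : M →+ N →+ BTensor k R M N :=
  AddMonoidHom.mk' (fun m => AddMonoidHom.mk' (fun n => btmul k R m n) (btmul_add k R m))
    (fun a b => by ext n; simp [add_btmul])

theorem btmulHom_apply (m : M) (n : N) : btmulHom k R M N m n = btmul k R m n := rfl

theorem tmul_one_smul_btmul (x : R) (m : M) (n : N) :
    (x ⊗ₜ[k] (1 : R)) • btmul k R m n = btmul k R ((x ⊗ₜ[k] (1 : R)) • m) n := by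
  rw [smul_btmul, ← Algebra.TensorProduct.one_def, one_smul]

theorem one_tmul_smul_btmul (y : R) (m : M) (n : N) :
    ((1 : R) ⊗ₜ[k] y) • btmul k R m n = btmul k R m (((1 : R) ⊗ₜ[k] y) • n) := by
  rw [smul_btmul, ← Algebra.TensorProduct.one_def, one_smul]

/-- The product `f • g : M • N → M₂ • N₂` of bimodule maps. -/
def bmap (f : M →ₗ[Env k R] M₂) (g : N →ₗ[Env k R] N₂) :
    BTensor k R M N →ₗ[Env k R] BTensor k R M₂ N₂ :=
  blift (((btmulHom k R M₂ N₂).comp f.toAddMonoidHom).compr₂ (AddMonoidHom.id _) |>.compl₂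
      g.toAddMonoidHom)
    (fun r m n => by simp [btmulHom_apply, btmul_balanced])
    (fun r m n => by simp [btmulHom_apply, tmul_one_smul_btmul])
    (fun r m n => by simp [btmulHom_apply, one_tmul_smul_btmul])

theorem bmap_btmul (f : M →ₗ[Env k R] M₂) (g : N →ₗ[Env k R] N₂) (m : M) (n : N) :
    bmap k R f g (btmul k R m n) = btmul k R (f m) (g n) := rfl

variable (M N P) in
/-- The triadditive map `(m, n, p) ↦ m • (n • p)`. -/
def btriR : M →+ N →+ P →+ BTensor k R M (BTensor k R N P) :=
  AddMonoidHom.mk' (fun m => AddMonoidHom.mk' (fun n => AddMonoidHom.mk'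
      (fun p => btmul k R m (btmul k R n p)) (fun a b => by simp [btmul_add]))
    (fun a b => by ext p; simp [add_btmul, btmul_add]))
    (fun a b => by ext n p; simp [add_btmul])

variable (M N P) in
/-- The triadditive map `(m, n, p) ↦ (m • n) • p`. -/
def btriL : M →+ N →+ P →+ BTensor k R (BTensor k R M N) P :=
  AddMonoidHom.mk' (fun m => AddMonoidHom.mk' (fun n => AddMonoidHom.mk'
      (fun p => btmul k R (btmul k R m n) p) (fun a b => by simp [btmul_add]))
    (fun a b => by ext p; simp [add_btmul, btmul_add]))
    (fun a b => by ext n p; simp [add_btmul])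

theorem btriR_apply (m : M) (n : N) (p : P) :
    btriR k R M N P m n p = btmul k R m (btmul k R n p) := rfl

theorem btriL_apply (m : M) (n : N) (p : P) :
    btriL k R M N P m n p = btmul k R (btmul k R m n) p := rfl

variable (M N P) in
/-- The biadditive map `(m • n, p) ↦ m • (n • p)`. -/
def bassocAux : BTensor k R M N →+ P →+ BTensor k R M (BTensor k R N P) :=
  bliftAdd (btriR k R M N P) (fun r m n => by
    ext p
    rw [btriR_apply, btriR_apply, btmul_balanced, tmul_one_smul_btmul])

theorem bassocAux_apply (m : M) (n : N) (p : P) :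
    bassocAux k R M N P (btmul k R m n) p = btmul k R m (btmul k R n p) := rfl

variable (M N P) in
/-- The biadditive map `(m, n • p) ↦ (m • n) • p`. -/
def bassocInvAux : M →+ BTensor k R N P →+ BTensor k R (BTensor k R M N) P :=
  AddMonoidHom.mk' (fun m => bliftAdd (btriL k R M N P m) (fun r n p => by
      rw [btriL_apply, btriL_apply, ← btmul_balanced, one_tmul_smul_btmul]))
    (fun a b => bt_addHom_ext k R fun n p => by
      rw [AddMonoidHom.add_apply, bliftAdd_btmul, bliftAdd_btmul, bliftAdd_btmul, map_add]
      rfl)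

theorem bassocInvAux_apply (m : M) (n : N) (p : P) :
    bassocInvAux k R M N P m (btmul k R n p) = btmul k R (btmul k R m n) p := rfl

variable (M N P) in
/-- The map `(M • N) • P → M • (N • P)`. -/
def bassocHom : BTensor k R (BTensor k R M N) P →ₗ[Env k R] BTensor k R M (BTensor k R N P) :=
  blift (bassocAux k R M N P)
    (fun r x p => by
      induction x using btensor_induction with
      | zero => simp
      | tmul m n => rw [one_tmul_smul_btmul, bassocAux_apply, bassocAux_apply, btmul_balanced]
      | add x y hx hy => simp only [smul_add, map_add, AddMonoidHom.add_apply, hx, hy])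
    (fun r x p => by
      induction x using btensor_induction with
      | zero => simp
      | tmul m n => rw [tmul_one_smul_btmul, bassocAux_apply, bassocAux_apply,
          tmul_one_smul_btmul]
      | add x y hx hy => simp only [smul_add, map_add, AddMonoidHom.add_apply, hx, hy])
    (fun r x p => by
      induction x using btensor_induction with
      | zero => simp
      | tmul m n => rw [bassocAux_apply, bassocAux_apply, one_tmul_smul_btmul,
          one_tmul_smul_btmul]
      | add x y hx hy => simp only [smul_add, map_add, AddMonoidHom.add_apply, hx, hy])

variable (M N P) in
/-- The map `M • (N • P) → (M • N) • P`. -/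
def bassocInv : BTensor k R M (BTensor k R N P) →ₗ[Env k R] BTensor k R (BTensor k R M N) P :=
  blift (bassocInvAux k R M N P)
    (fun r m x => by
      induction x using btensor_induction with
      | zero => simp
      | tmul n p => rw [tmul_one_smul_btmul, bassocInvAux_apply, bassocInvAux_apply,
          btmul_balanced]
      | add x y hx hy => simp only [smul_add, map_add, hx, hy])
    (fun r m x => by
      induction x using btensor_induction with
      | zero => simp
      | tmul n p => rw [bassocInvAux_apply, bassocInvAux_apply, tmul_one_smul_btmul,
          tmul_one_smul_btmul]
      | add x y hx hy => simp only [smul_add, map_add, hx, hy])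
    (fun r m x => by
      induction x using btensor_induction with
      | zero => simp
      | tmul n p => rw [one_tmul_smul_btmul, bassocInvAux_apply, bassocInvAux_apply,
          one_tmul_smul_btmul]
      | add x y hx hy => simp only [smul_add, map_add, hx, hy])

variable (M N P) in
/-- The associativity constraint `(M • N) • P ≅ M • (N • P)`. -/
def bassoc : BTensor k R (BTensor k R M N) P ≃ₗ[Env k R] BTensor k R M (BTensor k R N P) :=
  LinearEquiv.ofLinearMap (bassocHom k R M N P) (bassocInv k R M N P)
    (bt_hom_ext fun m x => by
      induction x using btensor_induction with
      | zero => rw [← btmulHom_apply, map_zero, map_zero, map_zero]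
      | tmul n p => rfl
      | add x y hx hy => rw [btmul_add, map_add, map_add, hx, hy])
    (bt_hom_ext fun x p => by
      induction x using btensor_induction with
      | zero => rw [← btmulHom_apply, map_zero, AddMonoidHom.zero_apply, map_zero, map_zero]
      | tmul m n => rfl
      | add x y hx hy => rw [add_btmul, map_add, map_add, hx, hy])

theorem bassoc_btmul (m : M) (n : N) (p : P) :
    bassoc k R M N P (btmul k R (btmul k R m n) p) = btmul k R m (btmul k R n p) := rfl

theorem bassoc_symm_btmul (m : M) (n : N) (p : P) :
    (bassoc k R M N P).symm (btmul k R m (btmul k R n p)) = btmul k R (btmul k R m n) p := rfl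

end BTensor

section Units

variable (N : Type u) [AddCommGroup N] [Module R N] (M : Type u) [AddCommGroup M]
  [Module (Env k R) M]

/-- An `R`-module `N` regarded as the `R`-bimodule on which the left and the right action both
are the given action. -/
def Diag (_k : Type v) (R N : Type u) [CommRing _k] [CommRing R] [Algebra _k R]
    [AddCommGroup N] [Module R N] : Type u := N

instance : AddCommGroup (Diag k R N) := inferInstanceAs (AddCommGroup N)

instance : Module (Env k R) (Diag k R N) :=
  Module.compHom N (Algebra.TensorProduct.lmul' k : Env k R →ₐ[k] R).toRingHom

/-- The identity map between `N` and the bimodule it defines. -/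
def diagEquiv : N ≃+ Diag k R N := AddEquiv.refl N

theorem smul_diag (x y : R) (n : N) :
    (x ⊗ₜ[k] y) • diagEquiv k R N n = diagEquiv k R N ((x * y) • n) := by
  change (Algebra.TensorProduct.lmul' k (x ⊗ₜ[k] y)) • n = (x * y) • n
  rw [Algebra.TensorProduct.lmul'_apply_tmul]

variable {N} in
/-- An `R`-linear map regarded as a bimodule map. -/
def diagMap {N₂ : Type u} [AddCommGroup N₂] [Module R N₂] (f : N →ₗ[R] N₂) :
    Diag k R N →ₗ[Env k R] Diag k R N₂ where
  toFun n := diagEquiv k R N₂ (f ((diagEquiv k R N).symm n))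
  map_add' a b := by simp
  map_smul' e n := f.map_smul (Algebra.TensorProduct.lmul' k e) n

/-- The bimodule `J = R`, the unit of the monoidal product `•`. -/
abbrev J : Type u := Diag k R R

/-- The left unit constraint `J • M ≅ M`, `r • m ↦ r · m`. -/
def blunit : BTensor k R (J k R) M ≃ₗ[Env k R] M :=
  LinearEquiv.ofLinearMap
    (blift (AddMonoidHom.mk' (fun r => DistribSMul.toAddMonoidHom M
        ((diagEquiv k R R).symm r ⊗ₜ[k] (1 : R)))
        (fun a b => by ext m; simp [TensorProduct.add_tmul, add_smul]))
      (fun r x m => by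
        obtain ⟨x, rfl⟩ := (diagEquiv k R R).surjective x
        simp [smul_diag, smul_smul, mul_comm])
      (fun r x m => by
        obtain ⟨x, rfl⟩ := (diagEquiv k R R).surjective x
        simp [smul_diag, smul_smul])
      (fun r x m => by simp [smul_smul]))
    (linOfAdd (AddMonoidHom.mk' (fun m => btmul k R (diagEquiv k R R 1) m) (btmul_add k R _))
      (fun r m => by
        simp [tmul_one_smul_btmul, ← btmul_balanced, smul_diag])
      (fun r m => by simp [one_tmul_smul_btmul]))
    (LinearMap.ext fun m => by
      change ((1 : R) ⊗ₜ[k] (1 : R)) • m = m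
      rw [← Algebra.TensorProduct.one_def, one_smul])
    (bt_hom_ext fun x m => by
      obtain ⟨x, rfl⟩ := (diagEquiv k R R).surjective x
      change btmul k R (diagEquiv k R R 1) ((x ⊗ₜ[k] (1 : R)) • m)
        = btmul k R (diagEquiv k R R x) m
      rw [← btmul_balanced, smul_diag, one_mul, smul_eq_mul, mul_one])

theorem blunit_btmul (r : R) (m : M) :
    blunit k R M (btmul k R (diagEquiv k R R r) m) = (r ⊗ₜ[k] (1 : R)) • m := rfl

theorem blunit_symm_apply (m : M) :
    (blunit k R M).symm m = btmul k R (diagEquiv k R R 1) m := rfl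

/-- The right unit constraint `M • J ≅ M`, `m • r ↦ m · r`. -/
def brunit : BTensor k R M (J k R) ≃ₗ[Env k R] M :=
  LinearEquiv.ofLinearMap
    (blift (AddMonoidHom.flip (AddMonoidHom.mk' (fun r => DistribSMul.toAddMonoidHom M
        ((1 : R) ⊗ₜ[k] (diagEquiv k R R).symm r))
        (fun a b => by ext m; simp [TensorProduct.tmul_add, add_smul])))
      (fun r m x => by
        obtain ⟨x, rfl⟩ := (diagEquiv k R R).surjective x
        simp [smul_diag, smul_smul, mul_comm])
      (fun r m x => by simp [smul_smul])
      (fun r m x => by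
        obtain ⟨x, rfl⟩ := (diagEquiv k R R).surjective x
        simp [smul_diag, smul_smul]))
    (linOfAdd (AddMonoidHom.mk' (fun m => btmul k R m (diagEquiv k R R 1))
        (fun a b => add_btmul k R a b _))
      (fun r m => by simp [tmul_one_smul_btmul])
      (fun r m => by simp [one_tmul_smul_btmul, btmul_balanced, smul_diag]))
    (LinearMap.ext fun m => by
      change ((1 : R) ⊗ₜ[k] (1 : R)) • m = m
      rw [← Algebra.TensorProduct.one_def, one_smul])
    (bt_hom_ext fun m x => by
      obtain ⟨x, rfl⟩ := (diagEquiv k R R).surjective x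
      change btmul k R (((1 : R) ⊗ₜ[k] x) • m) (diagEquiv k R R 1)
        = btmul k R m (diagEquiv k R R x)
      rw [btmul_balanced, smul_diag, mul_one, smul_eq_mul, mul_one])

theorem brunit_btmul (m : M) (r : R) :
    brunit k R M (btmul k R m (diagEquiv k R R r)) = ((1 : R) ⊗ₜ[k] r) • m := rfl

end Units

section Interchange

variable (M N M₂ N₂ : Type u) [AddCommGroup M] [AddCommGroup N]
  [AddCommGroup M₂] [AddCommGroup N₂] [Module (Env k R) M] [Module (Env k R) N]
  [Module (Env k R) M₂] [Module (Env k R) N₂]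

/-- The bilinear form of the interchange law. -/
def interchangeAux : BTensor k R M N →ₗ[Env k R] BTensor k R M₂ N₂ →ₗ[Env k R]
    BTensor k R (M ⊗[Env k R] M₂) (N ⊗[Env k R] N₂) :=
  blift (AddMonoidHom.mk' (fun m => AddMonoidHom.mk'
      (fun n => bmap k R (TensorProduct.mk (Env k R) M M₂ m) (TensorProduct.mk (Env k R) N N₂ n))
      (fun a b => bt_hom_ext fun p q => by simp [bmap_btmul, btmul_add]))
      (fun a b => by
        ext1 n
        exact bt_hom_ext fun p q => by simp [bmap_btmul, add_btmul]))
    (fun r m n => bt_hom_ext fun p q => by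
      simp [bmap_btmul, btmul_balanced])
    (fun r m n => bt_hom_ext fun p q => by
      simp [bmap_btmul, tmul_one_smul_btmul])
    (fun r m n => bt_hom_ext fun p q => by
      simp [bmap_btmul, one_tmul_smul_btmul])

/-- The interchange law
`(M • N) ∘ (M₂ • N₂) → (M ∘ M₂) • (N ∘ N₂)`, `(m • n) ∘ (p • q) ↦ (m ∘ p) • (n ∘ q)`. -/
def interchange : BTensor k R M N ⊗[Env k R] BTensor k R M₂ N₂ →ₗ[Env k R]
    BTensor k R (M ⊗[Env k R] M₂) (N ⊗[Env k R] N₂) :=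
  TensorProduct.lift (interchangeAux k R M N M₂ N₂)

theorem interchange_tmul (m : M) (n : N) (p : M₂) (q : N₂) :
    interchange k R M N M₂ N₂ (btmul k R m n ⊗ₜ[Env k R] btmul k R p q)
      = btmul k R (m ⊗ₜ[Env k R] p) (n ⊗ₜ[Env k R] q) := rfl

end Interchange

section Bialgebroid

variable (A : Type u) [Ring A] [Algebra (Env k R) A]

/-- The map `s : R → A`, `s r = η (r ⊗ 1)`, with values in the centre of `A`. -/
def src : R →+* A := (algebraMap (Env k R) A).comp
  (Algebra.TensorProduct.includeLeft : R →ₐ[k] Env k R).toRingHom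

/-- The map `t : R → A`, `t r = η (1 ⊗ r)`, with values in the centre of `A`. -/
def tgt : R →+* A := (algebraMap (Env k R) A).comp
  (Algebra.TensorProduct.includeRight : R →ₐ[k] Env k R).toRingHom

/-- An `R`-bialgebroid structure on a `k`-algebra `A` whose unit `η : R ⊗ R → A` lands in the
centre of `A`; equivalently, a bimonoid in the duoidal category of `R`-bimodules.  The monoid
structure with respect to `∘` is the given structure of an algebra over `Env k R = R ⊗ R`, with
`r · a = s(r) a` and `a · r = t(r) a`.  The fields give the `R`-coring structure `(Δ, ε)` and the
four compatibilities between the monoid and the comonoid structures (`Δ` and `ε` are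
multiplicative and unital). -/
structure Bialgebroid where
  /-- the comultiplication `Δ : A → A • A` -/
  comul : A →ₗ[Env k R] BTensor k R A A
  /-- the counit `ε : A → R` -/
  counit : A →ₗ[Env k R] J k R
  coassoc : ∀ a, bassoc k R A A A (bmap k R comul LinearMap.id (comul a))
    = bmap k R LinearMap.id comul (comul a)
  counit_left : ∀ a, blunit k R A (bmap k R counit LinearMap.id (comul a)) = a
  counit_right : ∀ a, brunit k R A (bmap k R LinearMap.id counit (comul a)) = a
  comul_mul : ∀ a b, comul (a * b)
    = bmap k R (LinearMap.mul' (Env k R) A) (LinearMap.mul' (Env k R) A)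
        (interchange k R A A A A (comul a ⊗ₜ[Env k R] comul b))
  comul_one : comul 1 = btmul k R 1 1
  counit_mul : ∀ a b, (diagEquiv k R R).symm (counit (a * b))
    = (diagEquiv k R R).symm (counit a) * (diagEquiv k R R).symm (counit b)
  counit_one : (diagEquiv k R R).symm (counit 1) = 1

variable {A}

theorem tmul_one_smul_eq (r : R) (a : A) : (r ⊗ₜ[k] (1 : R)) • a = src k R A r * a :=
  Algebra.smul_def _ _

theorem one_tmul_smul_eq (r : R) (a : A) : ((1 : R) ⊗ₜ[k] r) • a = tgt k R A r * a :=
  Algebra.smul_def _ _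

theorem src_comm (r : R) (a : A) : src k R A r * a = a * src k R A r :=
  Algebra.commutes _ _

theorem tgt_comm (r : R) (a : A) : tgt k R A r * a = a * tgt k R A r :=
  Algebra.commutes _ _

variable {k R} in
/-- The map `A • A → A`, `a • b ↦ a * S b`, for an additive map `S` with
`S (a s(r)) = t(r) S(a)`. -/
def mulAntipode (S : A →+ A) (hS : ∀ a r, S (a * src k R A r) = tgt k R A r * S a) :
    BTensor k R A A →+ A :=
  bliftAdd (AddMonoidHom.mul.compl₂ S) (fun r a b => by
    rw [one_tmul_smul_eq, tmul_one_smul_eq, src_comm]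
    simp only [AddMonoidHom.compl₂_apply, AddMonoidHom.mul_apply]
    rw [hS, tgt_comm, mul_assoc])

theorem mulAntipode_btmul (S : A →+ A) (hS) (a b : A) :
    mulAntipode (k := k) (R := R) S hS (btmul k R a b) = a * S b := rfl

variable {k R} in
/-- The map `A • A → A`, `a • b ↦ S a * b`, for an additive map `S` with
`S (t(r) a) = S(a) s(r)`. -/
def antipodeMul (S : A →+ A) (hS : ∀ a r, S (tgt k R A r * a) = S a * src k R A r) :
    BTensor k R A A →+ A :=
  bliftAdd (AddMonoidHom.mul.comp S) (fun r a b => by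
    rw [one_tmul_smul_eq, tmul_one_smul_eq]
    simp only [AddMonoidHom.comp_apply, AddMonoidHom.mul_apply]
    rw [hS, mul_assoc])

theorem antipodeMul_btmul (S : A →+ A) (hS) (a b : A) :
    antipodeMul (k := k) (R := R) S hS (btmul k R a b) = S a * b := rfl

variable {k R}

/-- An antipode: a `k`-linear map `S : A → A` with `S (a s(r)) = t(r) S(a)`,
`S (t(r) a) = S(a) s(r)`, `a₁ S(a₂) = s(ε(a))` and `S(a₁) a₂ = t(ε(a))`. -/
structure Antipode [Algebra k A] (B : Bialgebroid k R A) where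
  /-- the map `S` -/
  map : A →ₗ[k] A
  map_mul_src : ∀ a r, map (a * src k R A r) = tgt k R A r * map a
  map_tgt_mul : ∀ a r, map (tgt k R A r * a) = map a * src k R A r
  mul_map : ∀ a, mulAntipode map.toAddMonoidHom map_mul_src (B.comul a)
    = src k R A ((diagEquiv k R R).symm (B.counit a))
  map_mul : ∀ a, antipodeMul map.toAddMonoidHom map_tgt_mul (B.comul a)
    = tgt k R A ((diagEquiv k R R).symm (B.counit a))

/-- The bialgebroid is a Hopf algebroid (with right bialgebroid structure obtained by
interchanging `s` and `t`) if it has an antipode. -/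
def Bialgebroid.IsHopfAlgebroid [Algebra k A] (B : Bialgebroid k R A) : Prop :=
  Nonempty (Antipode B)

/-- A right comodule over the bialgebroid: an `R`-bimodule `Q` with a coassociative and counital
bimodule map `Q → Q • A`. -/
structure Comod (B : Bialgebroid k R A) where
  /-- the underlying bimodule -/
  carrier : Type u
  [addCommGroup : AddCommGroup carrier]
  [bimodule : Module (Env k R) carrier]
  /-- the coaction -/
  coact : carrier →ₗ[Env k R] BTensor k R carrier A
  coassoc : ∀ q, bassoc k R carrier A A (bmap k R coact LinearMap.id (coact q))
    = bmap k R LinearMap.id B.comul (coact q)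
  counit : ∀ q, brunit k R carrier (bmap k R LinearMap.id B.counit (coact q)) = q

attribute [instance] Comod.addCommGroup Comod.bimodule

variable {B : Bialgebroid k R A}

/-- A morphism of comodules: a bimodule map compatible with the coactions. -/
@[ext]
structure Comod.Hom (Q Q₂ : Comod B) where
  /-- the underlying bimodule map -/
  hom : Q.carrier →ₗ[Env k R] Q₂.carrier
  comm : ∀ q, Q₂.coact (hom q) = bmap k R hom LinearMap.id (Q.coact q)

theorem bmap_bmap {M N M₂ N₂ M₃ N₃ : Type u} [AddCommGroup M] [AddCommGroup N]
    [AddCommGroup M₂] [AddCommGroup N₂] [AddCommGroup M₃] [AddCommGroup N₃]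
    [Module (Env k R) M] [Module (Env k R) N] [Module (Env k R) M₂] [Module (Env k R) N₂]
    [Module (Env k R) M₃] [Module (Env k R) N₃]
    (f : M →ₗ[Env k R] M₂) (g : N →ₗ[Env k R] N₂) (f₂ : M₂ →ₗ[Env k R] M₃)
    (g₂ : N₂ →ₗ[Env k R] N₃) (x : BTensor k R M N) :
    bmap k R f₂ g₂ (bmap k R f g x) = bmap k R (f₂ ∘ₗ f) (g₂ ∘ₗ g) x := by
  induction x using btensor_induction with
  | zero => simp
  | tmul m n => rfl
  | add x y hx hy => simp only [map_add, hx, hy]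

theorem bmap_id {M N : Type u} [AddCommGroup M] [AddCommGroup N]
    [Module (Env k R) M] [Module (Env k R) N] (x : BTensor k R M N) :
    bmap k R (LinearMap.id : M →ₗ[Env k R] M) (LinearMap.id : N →ₗ[Env k R] N) x = x := by
  induction x using btensor_induction with
  | zero => simp
  | tmul m n => rfl
  | add x y hx hy => rw [map_add, hx, hy]

instance : Category (Comod B) where
  Hom Q Q₂ := Comod.Hom Q Q₂
  id Q := ⟨LinearMap.id, fun q => (bmap_id _).symm⟩
  comp f g := ⟨g.hom ∘ₗ f.hom, fun q => by
    rw [LinearMap.comp_apply, g.comm, f.comm, bmap_bmap]; rfl⟩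

/-- The functor `Q ↦ Q ∘ A` from comodules to bimodules. -/
def circFunctor (B : Bialgebroid k R A) : Comod B ⥤ ModuleCat.{u} (Env k R) where
  obj Q := ModuleCat.of (Env k R) (Q.carrier ⊗[Env k R] A)
  map f := ModuleCat.ofHom (TensorProduct.map f.hom LinearMap.id)
  map_id Q := by
    ext1
    exact TensorProduct.map_id
  map_comp f g := by
    ext1
    exact TensorProduct.ext' fun q a => rfl

/-- The functor `Q ↦ (Q ∘ J) • A` from comodules to bimodules. -/
def circJBulletFunctor (B : Bialgebroid k R A) : Comod B ⥤ ModuleCat.{u} (Env k R) where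
  obj Q := ModuleCat.of (Env k R) (BTensor k R (Q.carrier ⊗[Env k R] J k R) A)
  map f := ModuleCat.ofHom (bmap k R (TensorProduct.map f.hom LinearMap.id) LinearMap.id)
  map_id Q := by
    ext1
    refine LinearMap.ext fun x => ?_
    change bmap k R (TensorProduct.map LinearMap.id LinearMap.id) LinearMap.id x = x
    rw [TensorProduct.map_id, bmap_id]
  map_comp f g := by
    ext1
    refine LinearMap.ext fun x => ?_
    change bmap k R (TensorProduct.map (g.hom ∘ₗ f.hom) LinearMap.id) LinearMap.id x
      = bmap k R (TensorProduct.map g.hom LinearMap.id) LinearMap.id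
          (bmap k R (TensorProduct.map f.hom LinearMap.id) LinearMap.id x)
    rw [bmap_bmap, ← TensorProduct.map_comp]
    rfl

/-- The composite
`Q ∘ A → (Q • A) ∘ A ≅ (Q • A) ∘ (J • A) → (Q ∘ J) • (A ∘ A) → (Q ∘ J) • A`
of the coaction, the inverse left unit constraint, the interchange law and the multiplication. -/
def varsigmaMap (Q : Comod B) :
    Q.carrier ⊗[Env k R] A →ₗ[Env k R] BTensor k R (Q.carrier ⊗[Env k R] J k R) A :=
  bmap k R LinearMap.id (LinearMap.mul' (Env k R) A)
    ∘ₗ interchange k R Q.carrier A (J k R) A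
    ∘ₗ TensorProduct.map LinearMap.id (blunit k R A).symm.toLinearMap
    ∘ₗ TensorProduct.map Q.coact LinearMap.id

theorem varsigmaMap_tmul (Q : Comod B) (q : Q.carrier) (a : A) :
    varsigmaMap Q (q ⊗ₜ[Env k R] a)
      = bmap k R ((TensorProduct.mk (Env k R) Q.carrier (J k R)).flip (diagEquiv k R R 1))
          (LinearMap.mulRight (Env k R) a) (Q.coact q) := by
  change bmap k R LinearMap.id (LinearMap.mul' (Env k R) A)
    (interchange k R Q.carrier A (J k R) A
      (Q.coact q ⊗ₜ[Env k R] btmul k R (diagEquiv k R R 1) a)) = _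
  generalize Q.coact q = x
  induction x using btensor_induction with
  | zero => simp
  | tmul m n => rfl
  | add x y hx hy => simp only [TensorProduct.add_tmul, map_add, hx, hy]

/-- The natural transformation `ς : (-) ∘ A → ((-) ∘ J) • A`. -/
def varsigma (B : Bialgebroid k R A) : circFunctor B ⟶ circJBulletFunctor B where
  app Q := ModuleCat.ofHom (varsigmaMap Q)
  naturality Q Q₂ f := by
    ext1
    refine TensorProduct.ext' fun q a => ?_
    change varsigmaMap Q₂ (f.hom q ⊗ₜ[Env k R] a)
      = bmap k R (TensorProduct.map f.hom LinearMap.id) LinearMap.id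
          (varsigmaMap Q (q ⊗ₜ[Env k R] a))
    rw [varsigmaMap_tmul, varsigmaMap_tmul, f.comm, bmap_bmap, bmap_bmap]
    rfl

/-- The action `M ∘ A → M` of a right `A`-module whose bimodule structure is induced by `s`
and `t`. -/
def actMap (A M : Type u) [Ring A] [Algebra (Env k R) A] [AddCommGroup M] [Module (Env k R) M]
    [Module Aᵐᵒᵖ M] [IsScalarTower (Env k R) Aᵐᵒᵖ M] : M ⊗[Env k R] A →ₗ[Env k R] M :=
  TensorProduct.lift (LinearMap.mk₂ (Env k R) (fun (m : M) (a : A) => op a • m)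
    (fun m n a => smul_add _ _ _) (fun e m a => smul_comm _ _ _)
    (fun m a b => by rw [MulOpposite.op_add, add_smul]) (fun e m a => by rw [op_smul, smul_assoc]))

theorem actMap_tmul (A M : Type u) [Ring A] [Algebra (Env k R) A] [AddCommGroup M]
    [Module (Env k R) M] [Module Aᵐᵒᵖ M] [IsScalarTower (Env k R) Aᵐᵒᵖ M] (m : M) (a : A) :
    actMap A M (m ⊗ₜ[Env k R] a) = op a • m := rfl

/-- An `A`-Hopf module: a right `A`-module which is also a right `A`-comodule via the `R`-bimodule
structure induced by `s` and `t` (that is, `e • m = m (e • 1)` for `e` in `R ⊗ R`), such that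
`(m a)₀ • (m a)₁ = m₀ a₁ • m₁ a₂`. -/
structure HopfMod (B : Bialgebroid k R A) extends Comod B where
  [module : Module Aᵐᵒᵖ carrier]
  [scalarTower : IsScalarTower (Env k R) Aᵐᵒᵖ carrier]
  coact_act : ∀ (m : carrier) (a : A), coact (op a • m)
    = bmap k R (actMap A carrier) (LinearMap.mul' (Env k R) A)
        (interchange k R carrier A A A (coact m ⊗ₜ[Env k R] B.comul a))

attribute [instance] HopfMod.module HopfMod.scalarTower

/-- A morphism of Hopf modules: a morphism of right `A`-modules (hence of bimodules) compatible
with the coactions. -/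
@[ext]
structure HopfMod.Hom (M M₂ : HopfMod B) where
  /-- the underlying module map -/
  hom : M.carrier →ₗ[Aᵐᵒᵖ] M₂.carrier
  comm : ∀ m, M₂.coact (hom m) = bmap k R (hom.restrictScalars (Env k R)) LinearMap.id (M.coact m)

instance : Category (HopfMod B) where
  Hom M M₂ := HopfMod.Hom M M₂
  id M := ⟨LinearMap.id, fun m => (bmap_id _).symm⟩
  comp f g := ⟨g.hom ∘ₗ f.hom, fun m => by
    rw [LinearMap.comp_apply, g.comm, f.comm, bmap_bmap]; rfl⟩

section Comparison

variable (N : Type u) [AddCommGroup N] [Module R N]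

/-- The right `A`-module structure `(n • b) a = n • (b a)` of `N • A`. -/
instance diagTensorModule : Module Aᵐᵒᵖ (BTensor k R (Diag k R N) A) where
  smul a x := bmap k R LinearMap.id (LinearMap.mulRight (Env k R) (unop a)) x
  one_smul x := by
    change bmap k R LinearMap.id (LinearMap.mulRight (Env k R) (1 : A)) x = x
    rw [LinearMap.mulRight_one, bmap_id]
  mul_smul a b x := by
    change bmap k R LinearMap.id (LinearMap.mulRight (Env k R) (unop b * unop a)) x
      = bmap k R LinearMap.id (LinearMap.mulRight (Env k R) (unop a))
        (bmap k R LinearMap.id (LinearMap.mulRight (Env k R) (unop b)) x)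
    rw [bmap_bmap, LinearMap.mulRight_mul]
    rfl
  smul_zero a := map_zero _
  smul_add a := map_add _
  add_smul a b x := by
    change bmap k R LinearMap.id (LinearMap.mulRight (Env k R) (unop a + unop b)) x
      = bmap k R LinearMap.id (LinearMap.mulRight (Env k R) (unop a)) x
        + bmap k R LinearMap.id (LinearMap.mulRight (Env k R) (unop b)) x
    induction x using btensor_induction with
    | zero => simp
    | tmul m n => simp [bmap_btmul, mul_add, btmul_add]
    | add x y hx hy => rw [map_add, map_add, map_add, hx, hy]; abel
  zero_smul x := by
    change bmap k R LinearMap.id (LinearMap.mulRight (Env k R) (0 : A)) x = 0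
    induction x using btensor_induction with
    | zero => simp
    | tmul m n => rw [bmap_btmul, LinearMap.mulRight_apply, mul_zero, ← btmulHom_apply, map_zero]
    | add x y hx hy => rw [map_add, hx, hy, add_zero]

theorem op_smul_btmul (a : A) (n : Diag k R N) (b : A) :
    op a • btmul k R n b = btmul k R n (b * a) := rfl

instance : IsScalarTower (Env k R) Aᵐᵒᵖ (BTensor k R (Diag k R N) A) where
  smul_assoc e a x := by
    induction a using MulOpposite.rec' with | _ a => ?_
    induction x using btensor_induction with
    | zero => simp
    | add x y hx hy => simp only [smul_add, hx, hy]
    | tmul n b =>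
      induction e using TensorProduct.induction_on with
      | zero => simp
      | add c d hc hd => simp only [add_smul, hc, hd]
      | tmul x y =>
        obtain ⟨n, rfl⟩ := (diagEquiv k R N).surjective n
        have h : ((x ⊗ₜ[k] (1 : R)) • diagEquiv k R N n)
            = ((1 : R) ⊗ₜ[k] x) • diagEquiv k R N n := by
          rw [smul_diag, smul_diag, mul_one, one_mul]
        rw [op_smul_btmul, smul_btmul, h, btmul_balanced, smul_smul,
          Algebra.TensorProduct.tmul_mul_tmul, one_mul, mul_one, ← op_smul, op_smul_btmul,
          mul_smul_comm]

/-- The coaction `n • a ↦ (n • a₁) • a₂` of `N • A`. -/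
def diagTensorCoact (B : Bialgebroid k R A) :
    BTensor k R (Diag k R N) A →ₗ[Env k R] BTensor k R (BTensor k R (Diag k R N) A) A :=
  (bassoc k R (Diag k R N) A A).symm.toLinearMap ∘ₗ bmap k R LinearMap.id B.comul

theorem diagTensorCoact_btmul (B : Bialgebroid k R A) (n : Diag k R N) (a : A) :
    diagTensorCoact N B (btmul k R n a)
      = (bassoc k R (Diag k R N) A A).symm (btmul k R n (B.comul a)) := rfl

/-- The Hopf module `N • A` of an `R`-module `N`. -/
def diagTensorHopfMod (B : Bialgebroid k R A) : HopfMod B where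
  carrier := BTensor k R (Diag k R N) A
  coact := diagTensorCoact N B
  coassoc x := by
    induction x using btensor_induction with
    | zero => simp
    | add x y hx hy => simp only [map_add, hx, hy]
    | tmul n a =>
      have h1 : ∀ y : BTensor k R A A,
          bassoc k R (BTensor k R (Diag k R N) A) A A
            (bmap k R (diagTensorCoact N B) LinearMap.id
              ((bassoc k R (Diag k R N) A A).symm (btmul k R n y)))
          = (bassoc k R (Diag k R N) A (BTensor k R A A)).symm (btmul k R n
              (bassoc k R A A A (bmap k R B.comul LinearMap.id y))) := by
        intro y
        induction y using btensor_induction with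
        | zero => simp [← btmulHom_apply]
        | add x y hx hy => simp only [map_add, btmul_add, hx, hy]
        | tmul b c =>
          rw [bassoc_symm_btmul, bmap_btmul, bmap_btmul, diagTensorCoact_btmul]
          generalize B.comul b = z
          induction z using btensor_induction with
          | zero => simp [← btmulHom_apply]
          | add x y hx hy => simp only [map_add, btmul_add, add_btmul, hx, hy]
          | tmul d e => rfl
      have h2 : ∀ y : BTensor k R A A,
          bmap k R LinearMap.id B.comul
              ((bassoc k R (Diag k R N) A A).symm (btmul k R n y))
          = (bassoc k R (Diag k R N) A (BTensor k R A A)).symm (btmul k R n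
              (bmap k R LinearMap.id B.comul y)) := by
        intro y
        induction y using btensor_induction with
        | zero => simp [← btmulHom_apply]
        | add x y hx hy => simp only [map_add, btmul_add, hx, hy]
        | tmul b c => rfl
      rw [diagTensorCoact_btmul, h1, h2, B.coassoc]
  counit x := by
    induction x using btensor_induction with
    | zero => simp
    | add x y hx hy => simp only [map_add, hx, hy]
    | tmul n a =>
      have h : ∀ y : BTensor k R A A,
          brunit k R (BTensor k R (Diag k R N) A) (bmap k R LinearMap.id B.counit
            ((bassoc k R (Diag k R N) A A).symm (btmul k R n y)))
          = btmul k R n (brunit k R A (bmap k R LinearMap.id B.counit y)) := by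
        intro y
        induction y using btensor_induction with
        | zero => simp [← btmulHom_apply]
        | add x y hx hy => simp only [map_add, btmul_add, hx, hy]
        | tmul b c =>
          rw [bassoc_symm_btmul, bmap_btmul, bmap_btmul]
          obtain ⟨r, hr⟩ := (diagEquiv k R R).surjective (B.counit c)
          rw [← hr, brunit_btmul, brunit_btmul]
          exact one_tmul_smul_btmul k R r n b
      rw [diagTensorCoact_btmul, h, B.counit_right]
  coact_act x a := by
    induction x using btensor_induction with
    | zero => simp
    | add x y hx hy => simp only [smul_add, map_add, TensorProduct.add_tmul, hx, hy]
    | tmul n b =>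
      rw [op_smul_btmul, diagTensorCoact_btmul, diagTensorCoact_btmul, B.comul_mul]
      generalize B.comul a = y
      generalize B.comul b = x
      induction x using btensor_induction with
      | zero => simp [← btmulHom_apply]
      | add x z hx hz => simp only [TensorProduct.add_tmul, map_add, btmul_add, hx, hz]
      | tmul c d =>
        induction y using btensor_induction with
        | zero => simp [← btmulHom_apply]
        | add y z hy hz => simp only [TensorProduct.tmul_add, map_add, btmul_add, hy, hz]
        | tmul e f => rfl

end Comparison

/-- The comparison functor `N ↦ N • A` from `R`-modules, regarded as the bimodules with
coinciding left and right actions, to `A`-Hopf modules. -/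
def comparisonFunctor (B : Bialgebroid k R A) : ModuleCat.{u} R ⥤ HopfMod B where
  obj N := diagTensorHopfMod N B
  map {N N₂} f :=
    { hom :=
        { toFun := bmap k R (diagMap k R f.hom) LinearMap.id
          map_add' := map_add _
          map_smul' := fun a x => by
            change bmap k R (diagMap k R f.hom) LinearMap.id
                (bmap k R LinearMap.id (LinearMap.mulRight (Env k R) (unop a)) x)
              = bmap k R LinearMap.id (LinearMap.mulRight (Env k R) (unop a))
                (bmap k R (diagMap k R f.hom) LinearMap.id x)
            exact (bmap_bmap LinearMap.id (LinearMap.mulRight (Env k R) (unop a))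
                (diagMap k R f.hom) LinearMap.id x).trans
              (bmap_bmap (diagMap k R f.hom) LinearMap.id LinearMap.id
                (LinearMap.mulRight (Env k R) (unop a)) x).symm }
      comm := fun x => by
        change diagTensorCoact N₂ B (bmap k R (diagMap k R f.hom) LinearMap.id x)
          = bmap k R (bmap k R (diagMap k R f.hom) LinearMap.id) LinearMap.id
              (diagTensorCoact N B x)
        induction x using btensor_induction with
        | zero => simp
        | add x y hx hy => simp only [map_add, hx, hy]
        | tmul n a =>
          rw [bmap_btmul, diagTensorCoact_btmul, diagTensorCoact_btmul]
          change (bassoc k R (Diag k R N₂) A A).symm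
            (btmul k R (diagMap k R f.hom n) (B.comul a)) = _
          generalize B.comul a = y
          induction y using btensor_induction with
          | zero => simp [← btmulHom_apply]
          | add x y hx hy => simp only [map_add, btmul_add, hx, hy]
          | tmul b c => rfl }
  map_id N := HopfMod.Hom.ext (LinearMap.ext fun x => bmap_id x)
  map_comp f g := HopfMod.Hom.ext (LinearMap.ext fun x => by
    exact (bmap_bmap (diagMap k R f.hom) LinearMap.id (diagMap k R g.hom) LinearMap.id x).symm)

end Bialgebroid

end Bimod

end

noncomputable section

namespace Bimod

open CategoryTheory MulOpposite

variable {k : Type v} {R : Type u} [CommRing k] [CommRing R] [Algebra k R]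

/-! ### Generalities on the bimodule tensor products. -/

section Bimodules

variable {M N P Q Z M₂ N₂ : Type u} [AddCommGroup M] [AddCommGroup N] [AddCommGroup P]
  [AddCommGroup Q] [AddCommGroup Z] [AddCommGroup M₂] [AddCommGroup N₂]
  [Module (Env k R) M] [Module (Env k R) N] [Module (Env k R) P] [Module (Env k R) Q]
  [Module (Env k R) Z] [Module (Env k R) M₂] [Module (Env k R) N₂]

/-! The cycle (i) ⇒ (iii) ⇒ (ii) ⇒ (i) is proved. Call a map on a Hopf module trivial if `A` acts on
its values through ε. Every Hopf module morphism f : M → N • A has the form m ↦ p(m₀) • m₁ with p =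
(id • ε)f trivial, by the left counit law. Since N • A is generated over `A` by the coinvariant
elements n • 1, it follows that the comparison functor is full and faithful for every bialgebroid
(`hom_diagTensor_btmul`); only essential surjectivity is at stake.

(i) ⇒ (iii). Let M ∘_A J be the largest quotient of M on which `A` acts through ε. The map m ↦ [m₀]
• m₁ is a Hopf module morphism M → (M ∘_A J) • A, and [m] • a ↦ m₀ S(m₁) a is its inverse, as in the
classical fundamental theorem of Hopf modules (`HopfMod.unitInv_unitMap`,
`HopfMod.unitMap_antipodeProj`). That m₀ S(m₁) depends only on [m] follows from the identity b₁ S(a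
b₂) = S(a) s(ε(b)) of `Antipode.twist_eq`.

(iii) ⇒ (ii). With the diagonal coaction, Q ∘ A is a Hopf module, hence isomorphic to some N • A by
a map φ. Such a φ factors as (g • A) ς_Q with g : Q ∘ J → N (`hom_circHopfMod_tmul`). Both Q ∘ J and
N are obtained by making the action of `A` trivial, on Q ∘ A and on N • A respectively, so g is
bijective along with φ, and therefore so is ς_Q.

(ii) ⇒ (i). For the cofree comodule A • A, put ς⁻¹(((1 • d) ∘ 1) • 1) through (c • e) ∘ b ↦ c
t(ε(e)) b; the result is S(d). Naturality of ς along left multiplications and along Δ : A → A • A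
gives a₁ S(a₂) = s(ε(a)) (`translationFold_comul`), and the value of ς at (1 • a) ∘ 1 gives S(a₁) a₂
= t(ε(a)) (`counitFold_varsigmaInv`). -/

theorem zero_btmul (n : N) : btmul k R (0 : M) n = 0 := by
  rw [← btmulHom_apply, map_zero, AddMonoidHom.zero_apply]

theorem btmul_zero (m : M) : btmul k R m (0 : N) = 0 := by
  rw [← btmulHom_apply, map_zero]

/-- Bimodule maps out of `(M • N) ∘ (P • Q)` are determined by their values on pure tensors. -/
theorem circ_hom_ext {f g : BTensor k R M N ⊗[Env k R] BTensor k R P Q →ₗ[Env k R] Z}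
    (h : ∀ m n p q, f (btmul k R m n ⊗ₜ btmul k R p q) = g (btmul k R m n ⊗ₜ btmul k R p q)) :
    f = g := by
  refine TensorProduct.ext' fun x y => ?_
  induction x using btensor_induction with
  | zero => simp
  | add x z hx hz => simp only [TensorProduct.add_tmul, map_add, hx, hz]
  | tmul m n =>
    induction y using btensor_induction with
    | zero => simp
    | add y z hy hz => simp only [TensorProduct.tmul_add, map_add, hy, hz]
    | tmul p q => exact h m n p q

theorem bmap_bijective {f : M →ₗ[Env k R] M₂} {g : N →ₗ[Env k R] N₂}
    (hf : Function.Bijective f) (hg : Function.Bijective g) :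
    Function.Bijective (bmap k R f g) := by
  let ef := LinearEquiv.ofBijective f hf
  let eg := LinearEquiv.ofBijective g hg
  refine Function.bijective_iff_has_inverse.2
    ⟨bmap k R ef.symm.toLinearMap eg.symm.toLinearMap, fun x => ?_, fun x => ?_⟩
  · rw [bmap_bmap]
    convert bmap_id x
    · exact LinearMap.ext ef.symm_apply_apply
    · exact LinearMap.ext eg.symm_apply_apply
  · rw [bmap_bmap]
    convert bmap_id x
    · exact LinearMap.ext ef.apply_symm_apply
    · exact LinearMap.ext eg.apply_symm_apply

theorem diag_left_smul (N : Type u) [AddCommGroup N] [Module R N] (r : R) (n : Diag k R N) :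
    (r ⊗ₜ[k] (1 : R)) • n = ((1 : R) ⊗ₜ[k] r) • n := by
  obtain ⟨n, rfl⟩ := (diagEquiv k R N).surjective n
  rw [smul_diag, smul_diag, mul_one, one_mul]

end Bimodules

/-! ### The counit, trivial maps and morphisms of Hopf modules. -/

variable {A : Type u} [Ring A] [Algebra (Env k R) A] {B : Bialgebroid k R A}

/-- The scalar tower condition is the requirement that the bimodule structure be induced by s and t;
this makes it explicit. -/
theorem op_algebraMap_smul {M : Type u} [AddCommGroup M] [Module (Env k R) M] [Module Aᵐᵒᵖ M]
    [IsScalarTower (Env k R) Aᵐᵒᵖ M] (e : Env k R) (m : M) :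
    op (algebraMap (Env k R) A e) • m = e • m := by
  rw [Algebra.algebraMap_eq_smul_one, op_smul, smul_assoc, op_one, one_smul]

theorem op_src_smul {M : Type u} [AddCommGroup M] [Module (Env k R) M] [Module Aᵐᵒᵖ M]
    [IsScalarTower (Env k R) Aᵐᵒᵖ M] (r : R) (m : M) :
    op (src k R A r) • m = (r ⊗ₜ[k] (1 : R)) • m :=
  op_algebraMap_smul _ m

theorem op_tgt_smul {M : Type u} [AddCommGroup M] [Module (Env k R) M] [Module Aᵐᵒᵖ M]
    [IsScalarTower (Env k R) Aᵐᵒᵖ M] (r : R) (m : M) :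
    op (tgt k R A r) • m = ((1 : R) ⊗ₜ[k] r) • m :=
  op_algebraMap_smul _ m

/-- The counit with values in `R`. -/
def Bialgebroid.eps (B : Bialgebroid k R A) (a : A) : R := (diagEquiv k R R).symm (B.counit a)

theorem Bialgebroid.counit_eq (B : Bialgebroid k R A) (a : A) :
    B.counit a = diagEquiv k R R (B.eps a) := rfl

theorem Bialgebroid.eps_mul (B : Bialgebroid k R A) (a b : A) :
    B.eps (a * b) = B.eps a * B.eps b := B.counit_mul a b

theorem Bialgebroid.eps_one (B : Bialgebroid k R A) : B.eps 1 = 1 := B.counit_one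

/-- Follows from ε(1) = 1 and bilinearity over `R`, as both actions on `J` are multiplication. In
particular s is a section of ε. -/
theorem Bialgebroid.eps_algebraMap (B : Bialgebroid k R A) (x y : R) :
    B.eps (algebraMap (Env k R) A (x ⊗ₜ[k] y)) = x * y := by
  have h : B.counit (algebraMap (Env k R) A (x ⊗ₜ[k] y))
      = (x ⊗ₜ[k] y) • diagEquiv k R R (B.eps 1) := by
    rw [Algebra.algebraMap_eq_smul_one, map_smul, B.counit_eq]
  rw [smul_diag, B.eps_one, smul_eq_mul, mul_one] at h
  rw [Bialgebroid.eps, h, AddEquiv.symm_apply_apply]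

theorem Bialgebroid.eps_src (B : Bialgebroid k R A) (r : R) : B.eps (src k R A r) = r :=
  (B.eps_algebraMap r 1).trans (mul_one r)

/-- The map `id • ε : M • A → M`. -/
def counitMap (B : Bialgebroid k R A) (M : Type u) [AddCommGroup M] [Module (Env k R) M] :
    BTensor k R M A →ₗ[Env k R] M :=
  (brunit k R M).toLinearMap ∘ₗ bmap k R LinearMap.id B.counit

theorem counitMap_btmul {M : Type u} [AddCommGroup M] [Module (Env k R) M] (m : M) (a : A) :
    counitMap B M (btmul k R m a) = ((1 : R) ⊗ₜ[k] B.eps a) • m := rfl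

/-- A bimodule map `p` on a Hopf module is trivial on `A` if `p (m a) = p m · ε(a)`. -/
def HopfMod.IsTrivialMap (M : HopfMod B) {P : Type u} [AddCommGroup P] [Module (Env k R) P]
    (p : M.carrier →ₗ[Env k R] P) : Prop :=
  ∀ (b : A) (m : M.carrier), p (op b • m) = ((1 : R) ⊗ₜ[k] B.eps b) • p m

namespace HopfMod

variable {M : HopfMod B} {P : Type u} [AddCommGroup P] [Module (Env k R) P]
  {p : M.carrier →ₗ[Env k R] P}

/-- For a map `p` that is trivial on `A`, the map `m ↦ p m₀ • m₁` is `A`-linear. -/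
theorem IsTrivialMap.bmap_coact_act (hp : M.IsTrivialMap p) (b : A) (m : M.carrier) :
    bmap k R p LinearMap.id (M.coact (op b • m))
      = bmap k R p (LinearMap.mulRight (Env k R) b) (M.coact m) := by
  have hleft : ∀ (r : R) (m : M.carrier),
      (r ⊗ₜ[k] (1 : R)) • p m = ((1 : R) ⊗ₜ[k] r) • p m := fun r m => by
    rw [← map_smul, ← op_src_smul (A := A), hp, B.eps_src]
  rw [M.coact_act]
  generalize M.coact m = x
  induction x using btensor_induction with
  | zero => simp
  | add x y hx hy => simp only [TensorProduct.add_tmul, map_add, hx, hy]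
  | tmul m a =>
    -- Triviality turns p(m b₁) into p(m) · ε(b₁); balancing carries ε(b₁) over to the second
    -- factor, where the left counit law turns a (ε(b₁) · b₂) into a b.
    have key : ∀ y : BTensor k R A A, bmap k R p LinearMap.id
        (bmap k R (actMap A M.carrier) (LinearMap.mul' (Env k R) A)
          (interchange k R M.carrier A A A (btmul k R m a ⊗ₜ[Env k R] y)))
        = btmul k R (p m) (a * blunit k R A (bmap k R B.counit LinearMap.id y)) := by
      intro y
      induction y using btensor_induction with
      | zero => simp [btmul_zero]
      | add y z hy hz =>
        simp only [TensorProduct.tmul_add, map_add, mul_add, btmul_add, hy, hz]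
      | tmul b c =>
        rw [interchange_tmul, bmap_btmul, bmap_btmul, actMap_tmul, hp, btmul_balanced,
          bmap_btmul, B.counit_eq, blunit_btmul, mul_smul_comm]
        rfl
    rw [key, B.counit_left]
    rfl

/-- The bimodule map underlying a morphism of Hopf modules. -/
abbrev Hom.lin {M M₂ : HopfMod B} (f : M ⟶ M₂) : M.carrier →ₗ[Env k R] M₂.carrier :=
  (HopfMod.Hom.hom f).restrictScalars (Env k R)

theorem IsTrivialMap.comp {M M₂ : HopfMod B} {p : M₂.carrier →ₗ[Env k R] P}
    (hp : M₂.IsTrivialMap p) (f : M ⟶ M₂) : M.IsTrivialMap (p ∘ₗ Hom.lin f) := fun b m => by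
  change p (HopfMod.Hom.hom f (op b • m)) = _
  rw [map_smul, hp]
  rfl

/-- A bijective morphism of Hopf modules is an isomorphism. -/
def isoOfBijective {M M₂ : HopfMod B} (f : M ⟶ M₂)
    (hf : Function.Bijective (HopfMod.Hom.hom f)) : M ≅ M₂ where
  hom := f
  inv :=
    { hom := (LinearEquiv.ofBijective (HopfMod.Hom.hom f) hf).symm.toLinearMap
      comm := fun m => by
        obtain ⟨m, rfl⟩ := hf.2 m
        rw [f.comm, bmap_bmap]
        have h : ∀ x, (LinearEquiv.ofBijective (HopfMod.Hom.hom f) hf).symm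
            (HopfMod.Hom.hom f x) = x :=
          (LinearEquiv.ofBijective (HopfMod.Hom.hom f) hf).symm_apply_apply
        change M.coact ((LinearEquiv.ofBijective (HopfMod.Hom.hom f) hf).symm
          (HopfMod.Hom.hom f m)) = _
        rw [h]
        refine (bmap_id _).symm.trans ?_
        congr 2
        exact (LinearMap.ext h).symm }
  hom_inv_id := HopfMod.Hom.ext (LinearMap.ext fun x =>
    (LinearEquiv.ofBijective (HopfMod.Hom.hom f) hf).symm_apply_apply x)
  inv_hom_id := HopfMod.Hom.ext (LinearMap.ext fun x =>
    (LinearEquiv.ofBijective (HopfMod.Hom.hom f) hf).apply_symm_apply x)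

end HopfMod

/-! ### Morphisms into N • A, and full faithfulness of the comparison functor. -/

section Comparison

variable (N : Type u) [AddCommGroup N] [Module R N]

/-- Rests on the multiplicativity of ε. -/
theorem counitMap_op_smul (b : A) (x : BTensor k R (Diag k R N) A) :
    counitMap B (Diag k R N) (op b • x)
      = ((1 : R) ⊗ₜ[k] B.eps b) • counitMap B (Diag k R N) x := by
  induction x using btensor_induction with
  | zero => simp
  | add x y hx hy => simp only [smul_add, map_add, hx, hy]
  | tmul n a =>
    rw [op_smul_btmul, counitMap_btmul, counitMap_btmul, smul_smul, B.eps_mul,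
      Algebra.TensorProduct.tmul_mul_tmul, one_mul, mul_comm]

theorem isTrivialMap_counitMap :
    (diagTensorHopfMod N B).IsTrivialMap (counitMap B (Diag k R N)) :=
  counitMap_op_smul N

/-- Balancing moves ε(a₁) from the factor n to a₂, and the left counit law applies. This is why a
morphism into N • A can be recovered from its trivial part. -/
theorem bmap_counitMap_diagTensorCoact (x : BTensor k R (Diag k R N) A) :
    bmap k R (counitMap B (Diag k R N)) LinearMap.id (diagTensorCoact N B x) = x := by
  induction x using btensor_induction with
  | zero => simp
  | add x y hx hy => simp only [map_add, hx, hy]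
  | tmul n a =>
    have key : ∀ y : BTensor k R A A, bmap k R (counitMap B (Diag k R N)) LinearMap.id
        ((bassoc k R (Diag k R N) A A).symm (btmul k R n y))
        = btmul k R n (blunit k R A (bmap k R B.counit LinearMap.id y)) := by
      intro y
      induction y using btensor_induction with
      | zero => simp [btmul_zero]
      | add y z hy hz => simp only [btmul_add, map_add, hy, hz]
      | tmul b c =>
        rw [bassoc_symm_btmul, bmap_btmul, counitMap_btmul, btmul_balanced, bmap_btmul,
          B.counit_eq, blunit_btmul]
    rw [diagTensorCoact_btmul, key, B.counit_left]

/-- The elements n • 1 are coinvariant because Δ is unital, and they generate N • A over `A`. -/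
theorem diagTensorCoact_btmul_one (n : Diag k R N) :
    diagTensorCoact N B (btmul k R n 1) = btmul k R (btmul k R n 1) 1 := by
  rw [diagTensorCoact_btmul, B.comul_one, bassoc_symm_btmul]

variable {N}

/-- The `A`-trivial part `(id • ε) f` of a morphism `f` into `N • A`. -/
def trivialPart {M : HopfMod B} (f : M ⟶ diagTensorHopfMod N B) :
    M.carrier →ₗ[Env k R] Diag k R N :=
  counitMap B (Diag k R N) ∘ₗ HopfMod.Hom.lin f

theorem isTrivialMap_trivialPart {M : HopfMod B} (f : M ⟶ diagTensorHopfMod N B) :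
    M.IsTrivialMap (trivialPart f) :=
  (isTrivialMap_counitMap N).comp f

/-- A morphism `f` into `N • A` is `m ↦ (id • ε) f(m₀) • m₁`. -/
theorem hom_diagTensor_eq {M : HopfMod B} (f : M ⟶ diagTensorHopfMod N B) (m : M.carrier) :
    HopfMod.Hom.hom f m = bmap k R (trivialPart f) LinearMap.id (M.coact m) :=
  (bmap_counitMap_diagTensorCoact (B := B) N (HopfMod.Hom.hom f m)).symm.trans
    ((congrArg (bmap k R (counitMap B (Diag k R N)) LinearMap.id) (f.comm m)).trans
      (bmap_bmap _ _ _ _ _))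

theorem hom_diagTensor_act {M : HopfMod B} (f : M ⟶ diagTensorHopfMod N B) (a : A)
    (m : M.carrier) : HopfMod.Hom.hom f (op a • m)
      = bmap k R (trivialPart f) (LinearMap.mulRight (Env k R) a) (M.coact m) :=
  (hom_diagTensor_eq f _).trans ((isTrivialMap_trivialPart f).bmap_coact_act a m)

/-- Writing n • a as (n • 1) a, with n • 1 coinvariant, shows that f is induced by a map N → N₂.
This is the content of fullness. -/
theorem hom_diagTensor_btmul {N₂ : Type u} [AddCommGroup N₂] [Module R N₂]
    (f : diagTensorHopfMod N B ⟶ diagTensorHopfMod N₂ B) (n : Diag k R N) (a : A) :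
    HopfMod.Hom.hom f (btmul k R n a)
      = btmul k R (trivialPart f (btmul k R n (1 : A))) a := by
  have h : btmul k R n a = op a • btmul k R n (1 : A) := by rw [op_smul_btmul, one_mul]
  refine (congrArg (HopfMod.Hom.hom f) h).trans ((hom_diagTensor_act f a _).trans
    ((congrArg _ (diagTensorCoact_btmul_one N n)).trans
    ((bmap_btmul k R (trivialPart f) (LinearMap.mulRight (Env k R) a) (btmul k R n 1) 1).trans ?_)))
  rw [LinearMap.mulRight_apply, one_mul]

/-- The linear map `N → N₂` underlying a morphism `N • A → N₂ • A`. -/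
def diagTensorPreimage {N₂ : Type u} [AddCommGroup N₂] [Module R N₂]
    (f : diagTensorHopfMod N B ⟶ diagTensorHopfMod N₂ B) : N →ₗ[R] N₂ where
  toFun n := (diagEquiv k R N₂).symm (trivialPart f (btmul k R (diagEquiv k R N n) (1 : A)))
  map_add' a b := by
    rw [map_add, add_btmul]
    exact (congrArg _ (map_add (trivialPart f) _ _)).trans (map_add _ _ _)
  map_smul' r n := by
    have h : btmul k R (diagEquiv k R N (r • n)) (1 : A)
        = (r ⊗ₜ[k] (1 : R)) • btmul k R (diagEquiv k R N n) 1 := by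
      rw [tmul_one_smul_btmul, smul_diag, mul_one]
    rw [h]
    refine (congrArg _ (map_smul (trivialPart f) _ _)).trans ?_
    obtain ⟨m, hm⟩ := (diagEquiv k R N₂).surjective
      (trivialPart f (btmul k R (diagEquiv k R N n) (1 : A)))
    refine (congrArg _ (congrArg _ hm.symm)).trans ?_
    rw [smul_diag, mul_one, ← hm]
    rfl

variable (B) in
/-- The comparison functor is always full. -/
theorem comparisonFunctor_full : (comparisonFunctor B).Full where
  map_surjective {N N₂} f := by
    refine ⟨ModuleCat.ofHom (diagTensorPreimage f), HopfMod.Hom.ext (LinearMap.ext fun x => ?_)⟩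
    change bmap k R (diagMap k R (diagTensorPreimage f)) LinearMap.id x = HopfMod.Hom.lin f x
    refine LinearMap.congr_fun (bt_hom_ext (f := bmap k R (diagMap k R (diagTensorPreimage f))
      LinearMap.id) (g := HopfMod.Hom.lin f) fun n a => ?_) x
    exact (hom_diagTensor_btmul f n a).symm

variable (B) in
/-- The comparison functor is always faithful. -/
theorem comparisonFunctor_faithful : (comparisonFunctor B).Faithful where
  map_injective {N N₂ f g} h := by
    ext n
    -- As ε(1) = 1, the map id • ε recovers f(n) from f(n) • 1.
    have h1 : ∀ f : N ⟶ N₂, counitMap B (Diag k R N₂) (HopfMod.Hom.hom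
        ((comparisonFunctor B).map f) (btmul k R (diagEquiv k R N n) 1))
        = diagEquiv k R N₂ (f.hom n) := fun f => by
      change counitMap B (Diag k R N₂) (btmul k R (diagEquiv k R N₂ (f.hom n)) 1) = _
      rw [counitMap_btmul, B.eps_one, ← Algebra.TensorProduct.one_def, one_smul]
    have h2 := h1 f
    rw [h] at h2
    exact (diagEquiv k R N₂).injective (h2.symm.trans (h1 g))

end Comparison

/-! ### The Hopf module Q ∘ A, and the implication (iii) ⇒ (ii). -/

section Circ

/-- The right `A`-module structure `(q ∘ b) a = q ∘ b a` of `Q ∘ A`. -/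
instance circModule (Q : Comod B) : Module Aᵐᵒᵖ (Q.carrier ⊗[Env k R] A) where
  smul a x := LinearMap.lTensor Q.carrier (LinearMap.mulRight (Env k R) (unop a)) x
  one_smul x := by
    change LinearMap.lTensor Q.carrier (LinearMap.mulRight (Env k R) (1 : A)) x = x
    rw [LinearMap.mulRight_one, LinearMap.lTensor_id_apply]
  mul_smul a b x := by
    change LinearMap.lTensor Q.carrier (LinearMap.mulRight (Env k R) (unop b * unop a)) x
      = LinearMap.lTensor Q.carrier (LinearMap.mulRight (Env k R) (unop a))
        (LinearMap.lTensor Q.carrier (LinearMap.mulRight (Env k R) (unop b)) x)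
    rw [LinearMap.mulRight_mul, LinearMap.lTensor_comp_apply]
  smul_zero a := map_zero _
  smul_add a := map_add _
  add_smul a b x := by
    change LinearMap.lTensor Q.carrier (LinearMap.mulRight (Env k R) (unop a + unop b)) x
      = LinearMap.lTensor Q.carrier (LinearMap.mulRight (Env k R) (unop a)) x
        + LinearMap.lTensor Q.carrier (LinearMap.mulRight (Env k R) (unop b)) x
    induction x using TensorProduct.induction_on with
    | zero => simp
    | tmul q c => simp [mul_add, TensorProduct.tmul_add]
    | add x y hx hy => rw [map_add, map_add, map_add, hx, hy]; abel
  zero_smul x := by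
    change LinearMap.lTensor Q.carrier (LinearMap.mulRight (Env k R) (0 : A)) x = 0
    induction x using TensorProduct.induction_on with
    | zero => simp
    | tmul q c => simp
    | add x y hx hy => rw [map_add, hx, hy, add_zero]

theorem op_smul_circ_tmul (Q : Comod B) (a : A) (q : Q.carrier) (b : A) :
    op a • (q ⊗ₜ[Env k R] b) = q ⊗ₜ[Env k R] (b * a) := rfl

instance (Q : Comod B) : IsScalarTower (Env k R) Aᵐᵒᵖ (Q.carrier ⊗[Env k R] A) where
  smul_assoc e a x := by
    induction a using MulOpposite.rec' with | _ a => ?_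
    induction x using TensorProduct.induction_on with
    | zero => simp
    | add x y hx hy => simp only [smul_add, hx, hy]
    | tmul q b =>
      rw [← op_smul, op_smul_circ_tmul, op_smul_circ_tmul, mul_smul_comm,
        TensorProduct.tmul_smul]

variable (A) in
/-- The product `(M • A) ∘ (N • A) → (M ∘ N) • A`, `(m • a) ∘ (n • b) ↦ (m ∘ n) • a b`. -/
def circProd (M N : Type u) [AddCommGroup M] [AddCommGroup N] [Module (Env k R) M]
    [Module (Env k R) N] :
    BTensor k R M A ⊗[Env k R] BTensor k R N A →ₗ[Env k R] BTensor k R (M ⊗[Env k R] N) A :=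
  bmap k R LinearMap.id (LinearMap.mul' (Env k R) A) ∘ₗ interchange k R M A N A

theorem circProd_tmul {M N : Type u} [AddCommGroup M] [AddCommGroup N] [Module (Env k R) M]
    [Module (Env k R) N] (m : M) (a : A) (n : N) (b : A) :
    circProd A M N (btmul k R m a ⊗ₜ[Env k R] btmul k R n b)
      = btmul k R (m ⊗ₜ[Env k R] n) (a * b) := rfl

/-- The multiplication of `A • A`. -/
def bulletMul (k : Type v) (R A : Type u) [CommRing k] [CommRing R] [Algebra k R] [Ring A]
    [Algebra (Env k R) A] :
    BTensor k R A A ⊗[Env k R] BTensor k R A A →ₗ[Env k R] BTensor k R A A :=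
  bmap k R (LinearMap.mul' (Env k R) A) (LinearMap.mul' (Env k R) A) ∘ₗ interchange k R A A A A

theorem bulletMul_tmul (a b c d : A) :
    bulletMul k R A (btmul k R a b ⊗ₜ[Env k R] btmul k R c d) = btmul k R (a * c) (b * d) := rfl

/-- The diagonal coaction `q ∘ a ↦ (q₀ ∘ a₁) • q₁ a₂` of `Q ∘ A`. -/
def circCoact (Q : Comod B) :
    Q.carrier ⊗[Env k R] A →ₗ[Env k R] BTensor k R (Q.carrier ⊗[Env k R] A) A :=
  circProd A Q.carrier A ∘ₗ TensorProduct.map Q.coact B.comul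

theorem circCoact_tmul (Q : Comod B) (q : Q.carrier) (a : A) :
    circCoact Q (q ⊗ₜ[Env k R] a)
      = circProd A Q.carrier A (Q.coact q ⊗ₜ[Env k R] B.comul a) := rfl

/-- The associativity constraint is compatible with the products on three factors. -/
theorem bassoc_circProd (M : Type u) [AddCommGroup M] [Module (Env k R) M]
    (x : BTensor k R (BTensor k R M A) A) (y : BTensor k R (BTensor k R A A) A) :
    bassoc k R (M ⊗[Env k R] A) A A
        (bmap k R (circProd A M A) (LinearMap.mul' (Env k R) A)
          (interchange k R (BTensor k R M A) A (BTensor k R A A) A (x ⊗ₜ[Env k R] y)))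
      = bmap k R LinearMap.id (bulletMul k R A)
          (interchange k R M (BTensor k R A A) A (BTensor k R A A)
            (bassoc k R M A A x ⊗ₜ[Env k R] bassoc k R A A A y)) := by
  induction x using btensor_induction with
  | zero => simp
  | add x z hx hz => simp only [TensorProduct.add_tmul, map_add, hx, hz]
  | tmul u c =>
    induction u using btensor_induction with
    | zero => simp [zero_btmul]
    | add u v hu hv => simp only [add_btmul, TensorProduct.add_tmul, map_add, hu, hv]
    | tmul m a =>
      induction y using btensor_induction with
      | zero => simp
      | add y z hy hz => simp only [TensorProduct.tmul_add, map_add, hy, hz]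
      | tmul u f =>
        induction u using btensor_induction with
        | zero => simp [zero_btmul]
        | add u v hu hv => simp only [add_btmul, TensorProduct.tmul_add, map_add, hu, hv]
        | tmul d e => rfl

/-- Together with `bassoc_circProd` and `bmap_comul_circProd`, this expresses both iterated
coactions of q ∘ a as products of iterated coactions of q and of a, so that coassociativity of Q ∘ A
reduces to that of Q and of Δ. -/
theorem bmap_circCoact_circProd (Q : Comod B) (x : BTensor k R Q.carrier A)
    (y : BTensor k R A A) :
    bmap k R (circCoact Q) LinearMap.id (circProd A Q.carrier A (x ⊗ₜ[Env k R] y))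
      = bmap k R (circProd A Q.carrier A) (LinearMap.mul' (Env k R) A)
          (interchange k R (BTensor k R Q.carrier A) A (BTensor k R A A) A
            (bmap k R Q.coact LinearMap.id x ⊗ₜ[Env k R] bmap k R B.comul LinearMap.id y)) := by
  refine LinearMap.congr_fun (circ_hom_ext (f := bmap k R (circCoact Q) LinearMap.id
    ∘ₗ circProd A Q.carrier A) (g := bmap k R (circProd A Q.carrier A) (LinearMap.mul' (Env k R) A)
    ∘ₗ interchange k R (BTensor k R Q.carrier A) A (BTensor k R A A) A
    ∘ₗ TensorProduct.map (bmap k R Q.coact LinearMap.id) (bmap k R B.comul LinearMap.id))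
    fun m n p q => ?_) (x ⊗ₜ y)
  rfl

/-- The multiplicativity of Δ, applied in the second factor. -/
theorem bmap_comul_circProd {M : Type u} [AddCommGroup M] [Module (Env k R) M]
    (x : BTensor k R M A) (y : BTensor k R A A) :
    bmap k R LinearMap.id B.comul (circProd A M A (x ⊗ₜ[Env k R] y))
      = bmap k R LinearMap.id (bulletMul k R A)
          (interchange k R M (BTensor k R A A) A (BTensor k R A A)
            (bmap k R LinearMap.id B.comul x ⊗ₜ[Env k R] bmap k R LinearMap.id B.comul y)) := by
  refine LinearMap.congr_fun (circ_hom_ext (f := bmap k R LinearMap.id B.comul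
    ∘ₗ circProd A M A) (g := bmap k R LinearMap.id (bulletMul k R A)
    ∘ₗ interchange k R M (BTensor k R A A) A (BTensor k R A A)
    ∘ₗ TensorProduct.map (bmap k R LinearMap.id B.comul) (bmap k R LinearMap.id B.comul))
    fun m n p q => ?_) (x ⊗ₜ y)
  exact congrArg (btmul k R _) (B.comul_mul n q)

/-- The multiplicativity of ε; it yields the counit law of the diagonal coaction. -/
theorem counitMap_circProd {M : Type u} [AddCommGroup M] [Module (Env k R) M]
    (x : BTensor k R M A) (y : BTensor k R A A) :
    counitMap B (M ⊗[Env k R] A) (circProd A M A (x ⊗ₜ[Env k R] y))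
      = counitMap B M x ⊗ₜ[Env k R] counitMap B A y := by
  refine LinearMap.congr_fun (circ_hom_ext (f := counitMap B (M ⊗[Env k R] A)
    ∘ₗ circProd A M A) (g := TensorProduct.map (counitMap B M) (counitMap B A))
    fun m n p q => ?_) (x ⊗ₜ y)
  change counitMap B (M ⊗[Env k R] A) (btmul k R (m ⊗ₜ[Env k R] p) (n * q))
    = counitMap B M (btmul k R m n) ⊗ₜ[Env k R] counitMap B A (btmul k R p q)
  rw [counitMap_btmul, counitMap_btmul, counitMap_btmul, TensorProduct.smul_tmul',
    TensorProduct.tmul_smul, TensorProduct.smul_tmul', smul_smul, B.eps_mul,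
    Algebra.TensorProduct.tmul_mul_tmul, one_mul, mul_comm]

/-- Associativity of the product of `A` in both factors; with Δ(ba) = Δ(b)Δ(a) it gives the Hopf
module condition for Q ∘ A. -/
theorem circProd_bulletMul (Q : Comod B) (x : BTensor k R Q.carrier A) (y z : BTensor k R A A) :
    circProd A Q.carrier A (x ⊗ₜ[Env k R] bulletMul k R A (y ⊗ₜ[Env k R] z))
      = bmap k R (actMap A (Q.carrier ⊗[Env k R] A)) (LinearMap.mul' (Env k R) A)
        (interchange k R (Q.carrier ⊗[Env k R] A) A A A
          (circProd A Q.carrier A (x ⊗ₜ[Env k R] y) ⊗ₜ[Env k R] z)) := by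
  induction x using btensor_induction with
  | zero => simp
  | add x w hx hw => simp only [TensorProduct.add_tmul, map_add, hx, hw]
  | tmul m a =>
    induction y using btensor_induction with
    | zero => simp
    | add y w hy hw =>
      simp only [TensorProduct.add_tmul, TensorProduct.tmul_add, map_add, hy, hw]
    | tmul b c =>
      induction z using btensor_induction with
      | zero => simp
      | add z w hz hw => simp only [TensorProduct.tmul_add, map_add, hz, hw]
      | tmul d e =>
        rw [bulletMul_tmul, circProd_tmul, circProd_tmul, interchange_tmul, bmap_btmul,
          actMap_tmul, op_smul_circ_tmul, LinearMap.mul'_apply, mul_assoc]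

/-- The Hopf module `Q ∘ A` of a comodule `Q`, with diagonal coaction. -/
def circHopfMod (Q : Comod B) : HopfMod B where
  carrier := Q.carrier ⊗[Env k R] A
  coact := circCoact Q
  coassoc x := by
    induction x using TensorProduct.induction_on with
    | zero => simp
    | add x y hx hy => simp only [map_add, hx, hy]
    | tmul q a =>
      rw [circCoact_tmul, bmap_circCoact_circProd, bassoc_circProd, Q.coassoc, B.coassoc,
        bmap_comul_circProd]
  counit x := by
    change counitMap B (Q.carrier ⊗[Env k R] A) (circCoact Q x) = x
    induction x using TensorProduct.induction_on with
    | zero => simp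
    | add x y hx hy => simp only [map_add, hx, hy]
    | tmul q a =>
      rw [circCoact_tmul, counitMap_circProd]
      exact congrArg₂ _ (Q.counit q) (B.counit_right a)
  coact_act x a := by
    induction x using TensorProduct.induction_on with
    | zero => simp
    | add x y hx hy => simp only [smul_add, map_add, TensorProduct.add_tmul, hx, hy]
    | tmul q b =>
      rw [op_smul_circ_tmul, circCoact_tmul, circCoact_tmul, ← circProd_bulletMul]
      exact congrArg (fun y => circProd A Q.carrier A (Q.coact q ⊗ₜ[Env k R] y)) (B.comul_mul b a)

variable {Q : Comod B} {N : Type u} [AddCommGroup N] [Module R N]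

/-- The bimodule map `Q ∘ J → N` extending a bimodule map `Q → N`. -/
def circUnitLift {Q : Type u} [AddCommGroup Q] [Module (Env k R) Q] (p : Q →ₗ[Env k R] Diag k R N) :
    Q ⊗[Env k R] J k R →ₗ[Env k R] Diag k R N :=
  TensorProduct.lift (LinearMap.mk₂ (Env k R)
    (fun q j => ((1 : R) ⊗ₜ[k] (diagEquiv k R R).symm j) • p q)
    (fun q₁ q₂ j => by rw [map_add, smul_add])
    (fun e q j => by rw [map_smul, smul_comm])
    (fun q j₁ j₂ => by rw [map_add, TensorProduct.tmul_add, add_smul])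
    -- Linearity in the second variable holds because x ⊗ y acts through the product xy both on `J`
    -- and on N.
    (fun e q j => by
      obtain ⟨j, rfl⟩ := (diagEquiv k R R).surjective j
      induction e using TensorProduct.induction_on with
      | zero => simp
      | add e f he hf => rw [add_smul, map_add, TensorProduct.tmul_add, add_smul, he, hf, add_smul]
      | tmul x y =>
        obtain ⟨n, hn⟩ := (diagEquiv k R N).surjective (p q)
        rw [← hn, smul_diag, smul_diag, smul_diag, AddEquiv.symm_apply_apply,
          AddEquiv.symm_apply_apply, smul_diag, smul_smul, one_mul, smul_eq_mul, one_mul]))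

theorem circUnitLift_tmul {Q : Type u} [AddCommGroup Q] [Module (Env k R) Q]
    (p : Q →ₗ[Env k R] Diag k R N) (q : Q) (r : R) :
    circUnitLift p (q ⊗ₜ[Env k R] diagEquiv k R R r) = ((1 : R) ⊗ₜ[k] r) • p q := rfl

variable (B) in
/-- The map `id ∘ ε : M ∘ A → M ∘ J`. -/
def circCounit (M : Type u) [AddCommGroup M] [Module (Env k R) M] :
    M ⊗[Env k R] A →ₗ[Env k R] M ⊗[Env k R] J k R :=
  LinearMap.lTensor M B.counit

theorem circCounit_tmul {M : Type u} [AddCommGroup M] [Module (Env k R) M] (m : M) (a : A) :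
    circCounit B M (m ⊗ₜ[Env k R] a) = m ⊗ₜ[Env k R] diagEquiv k R R (B.eps a) := rfl

/-- The counit is split by s, and tensoring preserves surjections. -/
theorem circCounit_surjective (M : Type u) [AddCommGroup M] [Module (Env k R) M] :
    Function.Surjective (circCounit B M) := by
  refine LinearMap.lTensor_surjective M fun j => ?_
  obtain ⟨r, rfl⟩ := (diagEquiv k R R).surjective j
  exact ⟨src k R A r, by rw [B.counit_eq, B.eps_src]⟩

theorem circUnit_left_smul (M : Type u) [AddCommGroup M] [Module (Env k R) M] (r : R)
    (x : M ⊗[Env k R] J k R) : (r ⊗ₜ[k] (1 : R)) • x = ((1 : R) ⊗ₜ[k] r) • x := by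
  induction x using TensorProduct.induction_on with
  | zero => simp
  | add x y hx hy => rw [smul_add, smul_add, hx, hy]
  | tmul m j => rw [← TensorProduct.tmul_smul, ← TensorProduct.tmul_smul, diag_left_smul]

/-- By multiplicativity of ε, the map id ∘ ε is trivial on `A`; being also surjective, it lets Q ∘ J
play the role of (Q ∘ A) ∘_A J. -/
theorem circCounit_op_smul (Q : Comod B) (b : A) (x : Q.carrier ⊗[Env k R] A) :
    circCounit B Q.carrier (op b • x) = ((1 : R) ⊗ₜ[k] B.eps b) • circCounit B Q.carrier x := by
  induction x using TensorProduct.induction_on with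
  | zero => simp
  | add x y hx hy => simp only [smul_add, map_add, hx, hy]
  | tmul q a =>
    rw [op_smul_circ_tmul, circCounit_tmul, circCounit_tmul, ← TensorProduct.tmul_smul, smul_diag,
      B.eps_mul, one_mul, smul_eq_mul, mul_comm]

theorem bmap_circProd_one {Q : Type u} [AddCommGroup Q] [Module (Env k R) Q]
    (p : Q ⊗[Env k R] A →ₗ[Env k R] Diag k R N) (a : A) (x : BTensor k R Q A) :
    bmap k R p (LinearMap.mulRight (Env k R) a)
        (circProd A Q A (x ⊗ₜ[Env k R] btmul k R (1 : A) 1))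
      = bmap k R (circUnitLift (p ∘ₗ (TensorProduct.mk (Env k R) Q A).flip 1)) LinearMap.id
        (bmap k R ((TensorProduct.mk (Env k R) Q (J k R)).flip (diagEquiv k R R 1))
          (LinearMap.mulRight (Env k R) a) x) := by
  induction x using btensor_induction with
  | zero => simp
  | add x y hx hy => simp only [TensorProduct.add_tmul, map_add, hx, hy]
  | tmul q b =>
    rw [circProd_tmul, mul_one, bmap_btmul, bmap_btmul, bmap_btmul, LinearMap.flip_apply,
      TensorProduct.mk_apply, circUnitLift_tmul, ← Algebra.TensorProduct.one_def, one_smul]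
    rfl

/-- The factorisation f = (g • A) ς_Q, with g extending q ↦ p(q ∘ 1) for the trivial part p of f.
Since q ∘ a = (q ∘ 1) a and Δ(1) = 1 • 1, the value is p(q₀ ∘ 1) • q₁ a. -/
theorem hom_circHopfMod_tmul (f : circHopfMod Q ⟶ diagTensorHopfMod N B) (q : Q.carrier) (a : A) :
    HopfMod.Hom.hom f (q ⊗ₜ[Env k R] a)
      = bmap k R (circUnitLift (trivialPart f ∘ₗ
          (TensorProduct.mk (Env k R) Q.carrier A).flip 1)) LinearMap.id
          (varsigmaMap Q (q ⊗ₜ[Env k R] a)) := by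
  have h : q ⊗ₜ[Env k R] a = op a • (q ⊗ₜ[Env k R] (1 : A)) := by
    rw [op_smul_circ_tmul, one_mul]
  refine (congrArg (HopfMod.Hom.hom f) h).trans ((hom_diagTensor_act f a _).trans ?_)
  rw [varsigmaMap_tmul]
  refine Eq.trans ?_ (bmap_circProd_one (trivialPart f) a (Q.coact q))
  rw [← B.comul_one]
  rfl

/-- A trivial map satisfies p(q ∘ a) = p(q ∘ 1) · ε(a), so it factors through id ∘ ε. -/
theorem circUnitLift_trivialPart_circCounit (f : circHopfMod Q ⟶ diagTensorHopfMod N B)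
    (x : Q.carrier ⊗[Env k R] A) :
    circUnitLift (trivialPart f ∘ₗ (TensorProduct.mk (Env k R) Q.carrier A).flip 1)
      (circCounit B Q.carrier x) = trivialPart f x := by
  refine LinearMap.congr_fun (TensorProduct.ext' (g := circUnitLift (trivialPart f ∘ₗ
    (TensorProduct.mk (Env k R) Q.carrier A).flip 1) ∘ₗ circCounit B Q.carrier)
    (h := trivialPart f) fun q a => ?_) x
  have h : q ⊗ₜ[Env k R] a = op a • (q ⊗ₜ[Env k R] (1 : A)) := by
    rw [op_smul_circ_tmul, one_mul]
  exact (isTrivialMap_trivialPart f a (q ⊗ₜ[Env k R] (1 : A))).symm.trans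
    (congrArg (trivialPart f) h.symm)

/-- If `Q ∘ A` is isomorphic to a Hopf module `N • A`, then `ς_Q` is bijective. -/
theorem varsigmaMap_bijective (f : circHopfMod Q ≅ diagTensorHopfMod N B) :
    Function.Bijective (varsigmaMap Q) := by
  let φ : Q.carrier ⊗[Env k R] A →ₗ[Env k R] BTensor k R (Diag k R N) A := HopfMod.Hom.lin f.hom
  let φ' : BTensor k R (Diag k R N) A →ₗ[Env k R] Q.carrier ⊗[Env k R] A := HopfMod.Hom.lin f.inv
  have hφ' : ∀ x, φ' (φ x) = x := fun x =>
    LinearMap.congr_fun (congrArg HopfMod.Hom.hom f.hom_inv_id) x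
  have hφ : ∀ x, φ (φ' x) = x := fun x =>
    LinearMap.congr_fun (congrArg HopfMod.Hom.hom f.inv_hom_id) x
  have hφop : ∀ (a : A) x, φ' (op a • x) = op a • φ' x := fun a x =>
    map_smul (HopfMod.Hom.hom f.inv) (op a) x
  set g := circUnitLift (trivialPart f.hom ∘ₗ (TensorProduct.mk (Env k R) Q.carrier A).flip 1)
    with hg
  have hgh : ∀ x, g (circCounit B Q.carrier x) = counitMap B (Diag k R N) (φ x) :=
    circUnitLift_trivialPart_circCounit f.hom
  have hfac : ∀ x, φ x = bmap k R g LinearMap.id (varsigmaMap Q x) := fun x =>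
    LinearMap.congr_fun (TensorProduct.ext' (g := φ)
      (h := bmap k R g LinearMap.id ∘ₗ varsigmaMap Q) (hom_circHopfMod_tmul f.hom)) x
  -- The candidate inverse of g: lift n along id • ε to n • 1, apply φ⁻¹, and project to Q ∘ J.
  let g' : Diag k R N → Q.carrier ⊗[Env k R] J k R := fun n =>
    circCounit B Q.carrier (φ' (btmul k R n 1))
  -- The counterpart of `hgh`: (id ∘ ε) φ⁻¹ is trivial on `A`, so it factors through id • ε.
  have hg' : ∀ y, g' (counitMap B (Diag k R N) y) = circCounit B Q.carrier (φ' y) := by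
    intro y
    induction y using btensor_induction with
    | zero => simp [g', zero_btmul]
    | add x y hx hy =>
      simp only [g', map_add, add_btmul] at hx hy ⊢
      rw [hx, hy]
    | tmul n a =>
      have h : btmul k R n a = op a • btmul k R n (1 : A) := by rw [op_smul_btmul, one_mul]
      simp only [g']
      rw [counitMap_btmul, ← diag_left_smul, ← tmul_one_smul_btmul, map_smul, map_smul, h, hφop,
        circCounit_op_smul, circUnit_left_smul]
  have hbij : Function.Bijective g := by
    refine Function.bijective_iff_has_inverse.2 ⟨g', fun z => ?_, fun n => ?_⟩
    · obtain ⟨x, rfl⟩ := circCounit_surjective (B := B) Q.carrier z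
      rw [hgh, hg', hφ']
    · simp only [g']
      rw [hgh, hφ, counitMap_btmul, B.eps_one, ← Algebra.TensorProduct.one_def, one_smul]
  have hid : Function.Bijective (LinearMap.id : A →ₗ[Env k R] A) := Function.bijective_id
  have hb := bmap_bijective hbij hid
  have hφb : Function.Bijective φ := Function.bijective_iff_has_inverse.2 ⟨φ', hφ', hφ⟩
  -- In this factorisation φ and g • A are bijective, hence so is ς_Q.
  have hcomp : (bmap k R g LinearMap.id) ∘ varsigmaMap Q = φ := (funext hfac).symm
  exact (Function.Bijective.of_comp_iff' hb _).1 (hcomp ▸ hφb)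

variable (B) in
theorem isIso_varsigma_iff :
    IsIso (varsigma B) ↔ ∀ Q : Comod B, Function.Bijective (varsigmaMap Q) := by
  rw [NatTrans.isIso_iff_isIso_app]
  exact forall_congr' fun Q => ConcreteCategory.isIso_iff_bijective _

/-- Essential surjectivity at Q ∘ A provides the N to which `varsigmaMap_bijective` applies. -/
theorem isIso_varsigma_of_isEquivalence (h : (comparisonFunctor B).IsEquivalence) :
    IsIso (varsigma B) :=
  (isIso_varsigma_iff B).2 fun Q => varsigmaMap_bijective
    ((comparisonFunctor B).objObjPreimageIso (circHopfMod Q)).symm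

end Circ

/-! ### The quotient M ∘_A J and the morphism M → (M ∘_A J) • A. -/

section AugQuotient

namespace HopfMod

variable (M : HopfMod B)

/-- The subbimodule of a Hopf module `M` generated by the elements `m a - m · ε(a)`. -/
def augSubmodule : Submodule (Env k R) M.carrier :=
  Submodule.span (Env k R)
    {x | ∃ (b : A) (m : M.carrier), x = op b • m - ((1 : R) ⊗ₜ[k] B.eps b) • m}

/-- The largest quotient of a Hopf module on which `A` acts through the counit. -/
def AugQuotient : Type u := M.carrier ⧸ M.augSubmodule

instance : AddCommGroup M.AugQuotient := inferInstanceAs (AddCommGroup (M.carrier ⧸ M.augSubmodule))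

instance : Module R M.AugQuotient :=
  Module.compHom (M.carrier ⧸ M.augSubmodule)
    (Algebra.TensorProduct.includeRight : R →ₐ[k] Env k R).toRingHom

/-- The class of an element in the augmentation quotient. -/
def toAugQuotient : M.carrier →+ M.AugQuotient := M.augSubmodule.mkQ.toAddMonoidHom

theorem smul_toAugQuotient (r : R) (m : M.carrier) :
    r • M.toAugQuotient m = M.toAugQuotient (((1 : R) ⊗ₜ[k] r) • m) := rfl

theorem toAugQuotient_op_smul (b : A) (m : M.carrier) :
    M.toAugQuotient (op b • m) = M.toAugQuotient (((1 : R) ⊗ₜ[k] B.eps b) • m) :=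
  (Submodule.Quotient.eq M.augSubmodule).2 (Submodule.subset_span ⟨b, m, rfl⟩)

/-- The projection of a Hopf module to its augmentation quotient, as a bimodule map. -/
def augMk : M.carrier →ₗ[Env k R] Diag k R M.AugQuotient :=
  linOfAdd ((diagEquiv k R M.AugQuotient).toAddMonoidHom.comp M.toAugQuotient)
    -- Since r · m = m s(r) and ε(s(r)) = r, the left action agrees with the right one in the
    -- quotient.
    (fun r m => by
      change diagEquiv k R M.AugQuotient (M.toAugQuotient _)
        = (r ⊗ₜ[k] (1 : R)) • diagEquiv k R M.AugQuotient (M.toAugQuotient m)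
      rw [smul_diag, mul_one, smul_toAugQuotient, ← op_src_smul (A := A), toAugQuotient_op_smul,
        B.eps_src])
    (fun r m => by
      change diagEquiv k R M.AugQuotient (M.toAugQuotient _)
        = ((1 : R) ⊗ₜ[k] r) • diagEquiv k R M.AugQuotient (M.toAugQuotient m)
      rw [smul_diag, one_mul, smul_toAugQuotient])

theorem augMk_surjective : Function.Surjective M.augMk :=
  Submodule.Quotient.mk_surjective M.augSubmodule

theorem isTrivialMap_augMk : M.IsTrivialMap M.augMk := fun b m => by
  rw [← map_smul]
  exact M.toAugQuotient_op_smul b m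

/-- The map `M → (M ∘_A J) • A`, `m ↦ [m₀] • m₁`. -/
def unitMap : M.carrier →ₗ[Env k R] BTensor k R (Diag k R M.AugQuotient) A :=
  bmap k R M.augMk LinearMap.id ∘ₗ M.coact

theorem unitMap_op_smul (a : A) (m : M.carrier) : M.unitMap (op a • m) = op a • M.unitMap m := by
  refine (M.isTrivialMap_augMk.bmap_coact_act a m).trans ?_
  change _ = bmap k R LinearMap.id (LinearMap.mulRight (Env k R) a)
    (bmap k R M.augMk LinearMap.id (M.coact m))
  rw [bmap_bmap]
  rfl

/-- Colinearity is the coassociativity of M, projected to the quotient in the first factor. -/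
theorem diagTensorCoact_unitMap (m : M.carrier) :
    diagTensorCoact M.AugQuotient B (M.unitMap m)
      = bmap k R M.unitMap LinearMap.id (M.coact m) := by
  have h : ∀ x : BTensor k R M.carrier A,
      diagTensorCoact M.AugQuotient B (bmap k R M.augMk LinearMap.id x)
      = bmap k R (bmap k R M.augMk LinearMap.id) LinearMap.id
          ((bassoc k R M.carrier A A).symm (bmap k R LinearMap.id B.comul x)) := by
    intro x
    induction x using btensor_induction with
    | zero => simp
    | add x y hx hy => simp only [map_add, hx, hy]
    | tmul m a =>
      rw [bmap_btmul, diagTensorCoact_btmul, bmap_btmul]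
      change (bassoc k R _ A A).symm (btmul k R (M.augMk m) (B.comul a)) = _
      generalize B.comul a = y
      induction y using btensor_induction with
      | zero => simp [btmul_zero]
      | add x y hx hy => simp only [btmul_add, map_add, hx, hy]
      | tmul b c => rfl
  refine (h (M.coact m)).trans ?_
  rw [← M.coassoc, LinearEquiv.symm_apply_apply, bmap_bmap]
  rfl

/-- The morphism `M → (M ∘_A J) • A`, `m ↦ [m₀] • m₁` of Hopf modules. -/
def unitHom : M ⟶ diagTensorHopfMod M.AugQuotient B :=
  HopfMod.Hom.mk (M₂ := diagTensorHopfMod M.AugQuotient B)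
    { toFun := M.unitMap
      map_add' := map_add _
      map_smul' := fun a m => M.unitMap_op_smul (unop a) m }
    M.diagTensorCoact_unitMap

end HopfMod

end AugQuotient

/-! ### The implication (i) ⇒ (iii): the fundamental theorem of Hopf modules. -/

section AntipodeToEquivalence

theorem antipodeMul_one_tmul_smul (S : A →+ A) (hS) (r : R) (x : BTensor k R A A) :
    antipodeMul (k := k) S hS (((1 : R) ⊗ₜ[k] r) • x) = tgt k R A r * antipodeMul S hS x := by
  induction x using btensor_induction with
  | zero => simp
  | add x y hx hy => simp only [smul_add, map_add, mul_add, hx, hy]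
  | tmul a b =>
    rw [one_tmul_smul_btmul, antipodeMul_btmul, antipodeMul_btmul, one_tmul_smul_eq, tgt_comm,
      tgt_comm, mul_assoc]

/-- The map `(a • b) • c ↦ S(a) b g(c)`. -/
def antipodeMulMul (S g : A →+ A) (hS : ∀ a r, S (tgt k R A r * a) = S a * src k R A r)
    (hg : ∀ a r, g (a * src k R A r) = tgt k R A r * g a) :
    BTensor k R (BTensor k R A A) A →+ A :=
  bliftAdd ((AddMonoidHom.mul.compl₂ g).comp
      (antipodeMul S hS)) fun r x c => by
    simp only [AddMonoidHom.comp_apply, AddMonoidHom.compl₂_apply, AddMonoidHom.mul_apply]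
    rw [antipodeMul_one_tmul_smul, tmul_one_smul_eq, src_comm, hg, ← mul_assoc, tgt_comm]

variable [Algebra k A]

theorem Antipode.map_src_mul (S : Antipode B) (r : R) (a : A) :
    S.map (src k R A r * a) = tgt k R A r * S.map a := by
  rw [src_comm, S.map_mul_src]

/-- The map `a ↦ b₁ S(a b₂)`. -/
def Antipode.twist (S : Antipode B) (b : A) : A →+ A :=
  AddMonoidHom.mk' (fun a => mulAntipode S.map.toAddMonoidHom S.map_mul_src
      (bmap k R LinearMap.id (LinearMap.mulLeft (Env k R) a) (B.comul b))) fun a c => by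
    rw [← map_add]
    congr 1
    generalize B.comul b = y
    induction y using btensor_induction with
    | zero => simp
    | add x y hx hy => rw [map_add, hx, hy, map_add, map_add]; abel
    | tmul d e => simp only [bmap_btmul, LinearMap.mulLeft_apply, add_mul, btmul_add]

theorem Antipode.twist_apply (S : Antipode B) (b a : A) :
    S.twist b a = mulAntipode S.map.toAddMonoidHom S.map_mul_src
      (bmap k R LinearMap.id (LinearMap.mulLeft (Env k R) a) (B.comul b)) := rfl

/-- This is the balancing condition that lets a ↦ b₁ S(a b₂) take the place of S in `mulAntipode`
and serve as g in `antipodeMulMul`. -/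
theorem Antipode.twist_mul_src (S : Antipode B) (b a : A) (r : R) :
    S.twist b (a * src k R A r) = tgt k R A r * S.twist b a := by
  rw [S.twist_apply, S.twist_apply]
  generalize B.comul b = y
  induction y using btensor_induction with
  | zero => simp
  | add x y hx hy => simp only [map_add, mul_add, hx, hy]
  | tmul d e =>
    change d * S.map (a * src k R A r * e) = tgt k R A r * (d * S.map (a * e))
    rw [← src_comm, mul_assoc, S.map_src_mul, ← mul_assoc, ← tgt_comm, mul_assoc]

/-- The antipode axiom a₁ b₁ S(a₂ b₂) = s(ε(ab)) for the product ab, regrouped. -/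
theorem Antipode.mulAntipode_twist (S : Antipode B) (b a : A) :
    mulAntipode (S.twist b) (S.twist_mul_src b) (B.comul a)
      = src k R A (B.eps a * B.eps b) := by
  have h := S.mul_map (a * b)
  rw [B.comul_mul] at h
  refine Eq.trans ?_ (h.trans (congrArg _ (B.eps_mul a b)))
  generalize B.comul a = x
  induction x using btensor_induction with
  | zero => simp
  | add x y hx hy => simp only [TensorProduct.add_tmul, map_add, hx, hy]
  | tmul c d =>
    rw [mulAntipode_btmul, S.twist_apply]
    generalize B.comul b = y
    induction y using btensor_induction with
    | zero => simp
    | add x y hx hy => simp only [TensorProduct.tmul_add, map_add, mul_add, hx, hy]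
    | tmul e f => exact (mul_assoc _ _ _).symm

/-- The map `(c • d) • a ↦ S(c) d b₁ S(a b₂)`. -/
def Antipode.foldTwist (S : Antipode B) (b : A) : BTensor k R (BTensor k R A A) A →+ A :=
  antipodeMulMul S.map.toAddMonoidHom (S.twist b) S.map_tgt_mul (S.twist_mul_src b)

theorem Antipode.foldTwist_btmul (S : Antipode B) (b : A) (x : BTensor k R A A) (c : A) :
    S.foldTwist b (btmul k R x c)
      = antipodeMul S.map.toAddMonoidHom S.map_tgt_mul x * S.twist b c := rfl

/-- The identity `b₁ S(a b₂) = s(ε(b)) S(a)`. -/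
theorem Antipode.twist_eq (S : Antipode B) (b a : A) :
    S.twist b a = S.map a * src k R A (B.eps b) := by
  -- The element S(a₁) a₂ b₁ S(a₃ b₂) is computed in two ways, matched by coassociativity. Here
  -- S(a₁) a₂ is contracted first to t(ε(a₁)), which is absorbed into the argument of the twist.
  have h1 : ∀ x : BTensor k R A A, S.foldTwist b
      (bmap k R B.comul LinearMap.id x)
      = S.twist b (blunit k R A (bmap k R B.counit LinearMap.id x)) := by
    intro x
    induction x using btensor_induction with
    | zero => simp
    | add x y hx hy => simp only [map_add, hx, hy]
    | tmul c d =>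
      rw [bmap_btmul, bmap_btmul, S.foldTwist_btmul, S.map_mul, B.counit_eq, blunit_btmul,
        tmul_one_smul_eq, src_comm, S.twist_mul_src]
      rfl
  -- Here a₂ b₁ S(a₃ b₂) is contracted first to s(ε(a₂) ε(b)), and s(ε(a₂)) is absorbed as S(t(r) a)
  -- = S(a) s(r).
  have h2 : ∀ x : BTensor k R A A, S.foldTwist b
      ((bassoc k R A A A).symm (bmap k R LinearMap.id B.comul x))
      = S.map (brunit k R A (bmap k R LinearMap.id B.counit x)) * src k R A (B.eps b) := by
    intro x
    induction x using btensor_induction with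
    | zero => simp
    | add x y hx hy => simp only [map_add, add_mul, hx, hy]
    | tmul c d =>
      have h3 : ∀ y : BTensor k R A A, S.foldTwist b
          ((bassoc k R A A A).symm (btmul k R c y))
          = S.map c * mulAntipode (S.twist b) (S.twist_mul_src b) y := by
        intro y
        induction y using btensor_induction with
        | zero => simp [btmul_zero]
        | add x y hx hy => simp only [btmul_add, map_add, mul_add, hx, hy]
        | tmul e f => exact mul_assoc _ _ _
      rw [bmap_btmul, bmap_btmul, LinearMap.id_apply, B.counit_eq, brunit_btmul, h3, S.mulAntipode_twist,
        one_tmul_smul_eq, S.map_tgt_mul, _root_.map_mul, mul_assoc]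
  have h4 := (bassoc k R A A A).symm_apply_apply (bmap k R B.comul LinearMap.id (B.comul a))
  rw [B.coassoc] at h4
  have h5 := h1 (B.comul a)
  rw [← h4, h2, B.counit_left, B.counit_right] at h5
  exact h5.symm

namespace HopfMod

variable {M : HopfMod B}

/-- The map `M • A → M`, `m • a ↦ m S(a)`. -/
def antipodeAct (M : HopfMod B) (S : Antipode B) : BTensor k R M.carrier A →+ M.carrier :=
  bliftAdd (AddMonoidHom.mk' (fun m => AddMonoidHom.mk' (fun a => op (S.map a) • m)
      (fun a b => by rw [map_add, MulOpposite.op_add, add_smul]))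
      (fun m n => by ext a; exact smul_add _ _ _)) fun r m a => by
    simp only [AddMonoidHom.mk'_apply]
    rw [← op_tgt_smul (A := A), smul_smul, ← op_mul, tmul_one_smul_eq, S.map_src_mul]

theorem antipodeAct_btmul (S : Antipode B) (m : M.carrier) (a : A) :
    M.antipodeAct S (btmul k R m a) = op (S.map a) • m := rfl

theorem antipodeAct_tmul_one_smul (S : Antipode B) (r : R) (x : BTensor k R M.carrier A) :
    M.antipodeAct S ((r ⊗ₜ[k] (1 : R)) • x) = op (src k R A r) • M.antipodeAct S x := by
  induction x using btensor_induction with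
  | zero => simp
  | add x y hx hy => simp only [smul_add, map_add, hx, hy]
  | tmul m a =>
    rw [tmul_one_smul_btmul, antipodeAct_btmul, antipodeAct_btmul, ← op_src_smul (A := A),
      smul_smul, smul_smul, ← op_mul, ← op_mul, src_comm]

theorem antipodeAct_one_tmul_smul (S : Antipode B) (r : R) (x : BTensor k R M.carrier A) :
    M.antipodeAct S (((1 : R) ⊗ₜ[k] r) • x) = op (src k R A r) • M.antipodeAct S x := by
  induction x using btensor_induction with
  | zero => simp
  | add x y hx hy => simp only [smul_add, map_add, hx, hy]
  | tmul m a =>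
    rw [one_tmul_smul_btmul, antipodeAct_btmul, antipodeAct_btmul, one_tmul_smul_eq,
      S.map_tgt_mul, op_mul, mul_smul]

/-- The map `M → M`, `m ↦ m₀ S(m₁)`. -/
def antipodeProj (M : HopfMod B) (S : Antipode B) : M.carrier →+ M.carrier :=
  (M.antipodeAct S).comp M.coact.toAddMonoidHom

theorem antipodeProj_apply (S : Antipode B) (m : M.carrier) :
    M.antipodeProj S m = M.antipodeAct S (M.coact m) := rfl

/-- The left action on m₀ is already multiplication by s, and the right action on m₁ becomes so
because S(t(r) a) = S(a) s(r). Hence only the product xy matters. -/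
theorem antipodeProj_tmul_smul (S : Antipode B) (x y : R) (m : M.carrier) :
    M.antipodeProj S ((x ⊗ₜ[k] y) • m) = op (src k R A (x * y)) • M.antipodeProj S m := by
  have h : x ⊗ₜ[k] y = (x ⊗ₜ[k] (1 : R)) * ((1 : R) ⊗ₜ[k] y) := by simp
  rw [antipodeProj_apply, map_smul, h, mul_smul, antipodeAct_tmul_one_smul,
    antipodeAct_one_tmul_smul, smul_smul, ← op_mul, ← map_mul, mul_comm]
  rfl

/-- By the Hopf module condition and `Antipode.twist_eq`, m₀ b₁ S(m₁ b₂) = m₀ S(m₁) s(ε(b));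
antimultiplicativity of S is not needed. This makes m ↦ m₀ S(m₁) descend to the quotient. -/
theorem antipodeProj_op_smul (S : Antipode B) (b : A) (m : M.carrier) :
    M.antipodeProj S (op b • m) = M.antipodeProj S (((1 : R) ⊗ₜ[k] B.eps b) • m) := by
  rw [antipodeProj_tmul_smul, one_mul, antipodeProj_apply, antipodeProj_apply, M.coact_act]
  generalize M.coact m = x
  induction x using btensor_induction with
  | zero => simp
  | add x y hx hy => simp only [TensorProduct.add_tmul, map_add, smul_add, hx, hy]
  | tmul m a =>
    have h : ∀ y : BTensor k R A A, M.antipodeAct S (bmap k R (actMap A M.carrier)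
        (LinearMap.mul' (Env k R) A)
        (interchange k R M.carrier A A A (btmul k R m a ⊗ₜ[Env k R] y)))
        = op (mulAntipode S.map.toAddMonoidHom S.map_mul_src
            (bmap k R LinearMap.id (LinearMap.mulLeft (Env k R) a) y)) • m := by
      intro y
      induction y using btensor_induction with
      | zero => simp
      | add x y hx hy => simp only [TensorProduct.tmul_add, map_add, MulOpposite.op_add, add_smul, hx, hy]
      | tmul b c =>
        rw [interchange_tmul, bmap_btmul, antipodeAct_btmul, actMap_tmul, smul_smul, ← op_mul]
        rfl
    rw [h, ← S.twist_apply, S.twist_eq, antipodeAct_btmul, smul_smul, ← op_mul]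

/-- The map `M ∘_A J → M`, `[m] ↦ m₀ S(m₁)`. -/
def antipodeSection (M : HopfMod B) (S : Antipode B) : Diag k R M.AugQuotient →+ M.carrier :=
  QuotientAddGroup.lift M.augSubmodule.toAddSubgroup (M.antipodeProj S) fun x hx => by
    change M.antipodeProj S x = 0
    refine Submodule.span_induction (p := fun x _ => M.antipodeProj S x = 0) ?_ (map_zero _)
      (fun x y _ _ hx hy => by rw [map_add, hx, hy, add_zero]) (fun e x _ hx => ?_) hx
    · rintro x ⟨b, m, rfl⟩
      rw [map_sub, antipodeProj_op_smul, sub_self]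
    · induction e using TensorProduct.induction_on with
      | zero => simp
      | add e f he hf => rw [add_smul, map_add, he, hf, add_zero]
      | tmul x y => rw [antipodeProj_tmul_smul, hx, smul_zero]

theorem antipodeSection_augMk (S : Antipode B) (m : M.carrier) :
    M.antipodeSection S (M.augMk m) = M.antipodeProj S m := rfl

/-- The map `(M ∘_A J) • A → M`, `[m] • a ↦ m₀ S(m₁) a`. -/
def unitInv (M : HopfMod B) (S : Antipode B) :
    BTensor k R (Diag k R M.AugQuotient) A →+ M.carrier :=
  bliftAdd (AddMonoidHom.mk' (fun n => AddMonoidHom.mk' (fun a => op a • M.antipodeSection S n)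
      (fun a b => by rw [MulOpposite.op_add, add_smul]))
      (fun m n => by ext a; simp)) fun r n a => by
    obtain ⟨m, rfl⟩ := M.augMk_surjective n
    simp only [AddMonoidHom.mk'_apply]
    rw [← map_smul M.augMk, antipodeSection_augMk, antipodeSection_augMk, antipodeProj_tmul_smul, one_mul,
      smul_smul, ← op_mul, tmul_one_smul_eq]

theorem unitInv_btmul (S : Antipode B) (m : M.carrier) (a : A) :
    M.unitInv S (btmul k R (M.augMk m) a) = op a • M.antipodeProj S m := rfl

/-- The map `(M • A) • A → M`, `(m • a) • b ↦ m S(a) b`. -/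
def antipodeActAct (M : HopfMod B) (S : Antipode B) :
    BTensor k R (BTensor k R M.carrier A) A →+ M.carrier :=
  bliftAdd (AddMonoidHom.mk' (fun x => AddMonoidHom.mk' (fun a => op a • M.antipodeAct S x)
      (fun a b => by rw [MulOpposite.op_add, add_smul]))
      (fun m n => by ext a; simp)) fun r x a => by
    simp only [AddMonoidHom.mk'_apply]
    rw [antipodeAct_one_tmul_smul, smul_smul, ← op_mul, tmul_one_smul_eq]

theorem antipodeActAct_btmul (S : Antipode B) (x : BTensor k R M.carrier A) (a : A) :
    M.antipodeActAct S (btmul k R x a) = op a • M.antipodeAct S x := rfl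

/-- The composite is m₀ S(m₁) m₂ = m₀ t(ε(m₁)) = m, by coassociativity, the second antipode identity
and the counit law. -/
theorem unitInv_unitMap (S : Antipode B) (m : M.carrier) : M.unitInv S (M.unitMap m) = m := by
  have h1 : ∀ x : BTensor k R M.carrier A, M.unitInv S (bmap k R M.augMk LinearMap.id x)
      = M.antipodeActAct S (bmap k R M.coact LinearMap.id x) := by
    intro x
    induction x using btensor_induction with
    | zero => simp
    | add x y hx hy => simp only [map_add, hx, hy]
    | tmul m a => rfl
  have h2 : ∀ x : BTensor k R M.carrier A, M.antipodeActAct S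
      ((bassoc k R M.carrier A A).symm (bmap k R LinearMap.id B.comul x))
      = brunit k R M.carrier (bmap k R LinearMap.id B.counit x) := by
    intro x
    induction x using btensor_induction with
    | zero => simp
    | add x y hx hy => simp only [map_add, hx, hy]
    | tmul m a =>
      have h3 : ∀ y : BTensor k R A A, M.antipodeActAct S
          ((bassoc k R M.carrier A A).symm (btmul k R m y))
          = op (antipodeMul S.map.toAddMonoidHom S.map_tgt_mul y) • m := by
        intro y
        induction y using btensor_induction with
        | zero => simp [btmul_zero]
        | add x y hx hy => simp only [btmul_add, map_add, MulOpposite.op_add, add_smul, hx, hy]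
        | tmul b c =>
          rw [bassoc_symm_btmul, antipodeActAct_btmul, antipodeAct_btmul, smul_smul, ← op_mul]
          rfl
      rw [bmap_btmul, bmap_btmul, LinearMap.id_apply, h3, S.map_mul, op_tgt_smul, B.counit_eq, brunit_btmul]
      rfl
  refine (h1 (M.coact m)).trans ?_
  rw [← LinearEquiv.symm_apply_apply (bassoc k R M.carrier A A)
    (bmap k R M.coact LinearMap.id (M.coact m)), M.coassoc, h2, M.counit]

/-- The map `(M • A) • A → (M ∘_A J) • A`, `(m • a) • b ↦ [m] • a S(b)`. -/
def augAntipode (M : HopfMod B) (S : Antipode B) :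
    BTensor k R (BTensor k R M.carrier A) A →+ BTensor k R (Diag k R M.AugQuotient) A :=
  bliftAdd (AddMonoidHom.mk' (fun x => AddMonoidHom.mk'
      (fun a => op (S.map a) • bmap k R M.augMk LinearMap.id x)
      (fun a b => by rw [map_add, MulOpposite.op_add, add_smul]))
      (fun m n => by ext a; simp)) fun r x a => by
    simp only [AddMonoidHom.mk'_apply]
    rw [map_smul, ← op_tgt_smul (A := A), smul_smul, ← op_mul, tmul_one_smul_eq, S.map_src_mul]

theorem augAntipode_btmul (S : Antipode B) (x : BTensor k R M.carrier A) (a : A) :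
    M.augAntipode S (btmul k R x a) = op (S.map a) • bmap k R M.augMk LinearMap.id x := rfl

/-- By `A`-linearity, m₀ S(m₁) is sent to [m₀] • m₁ S(m₂) = [m₀] • s(ε(m₁)), and balancing turns
this into [m] • 1. -/
theorem unitMap_antipodeProj (S : Antipode B) (m : M.carrier) :
    M.unitMap (M.antipodeProj S m) = btmul k R (M.augMk m) 1 := by
  have h1 : ∀ x : BTensor k R M.carrier A, M.unitMap (M.antipodeAct S x)
      = M.augAntipode S (bmap k R M.coact LinearMap.id x) := by
    intro x
    induction x using btensor_induction with
    | zero => simp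
    | add x y hx hy => simp only [map_add, hx, hy]
    | tmul m a =>
      rw [antipodeAct_btmul, unitMap_op_smul, bmap_btmul, augAntipode_btmul]
      rfl
  have h2 : ∀ x : BTensor k R M.carrier A, M.augAntipode S
      ((bassoc k R M.carrier A A).symm (bmap k R LinearMap.id B.comul x))
      = btmul k R (M.augMk (brunit k R M.carrier (bmap k R LinearMap.id B.counit x))) 1 := by
    intro x
    induction x using btensor_induction with
    | zero => simp [zero_btmul]
    | add x y hx hy => simp only [map_add, add_btmul, hx, hy]
    | tmul m a =>
      have h3 : ∀ y : BTensor k R A A, M.augAntipode S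
          ((bassoc k R M.carrier A A).symm (btmul k R m y))
          = btmul k R (M.augMk m) (mulAntipode S.map.toAddMonoidHom S.map_mul_src y) := by
        intro y
        induction y using btensor_induction with
        | zero => simp [btmul_zero]
        | add x y hx hy => simp only [btmul_add, map_add, hx, hy]
        | tmul b c => rfl
      rw [bmap_btmul, bmap_btmul, LinearMap.id_apply, h3, S.mul_map, B.counit_eq, brunit_btmul, map_smul,
        btmul_balanced, tmul_one_smul_eq, mul_one]
      rfl
  rw [antipodeProj_apply, h1, ← LinearEquiv.symm_apply_apply (bassoc k R M.carrier A A)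
    (bmap k R M.coact LinearMap.id (M.coact m)), M.coassoc, h2, M.counit]

theorem unitMap_unitInv (S : Antipode B) (x : BTensor k R (Diag k R M.AugQuotient) A) :
    M.unitMap (M.unitInv S x) = x := by
  induction x using btensor_induction with
  | zero => simp
  | add x y hx hy => simp only [map_add, hx, hy]
  | tmul n a =>
    obtain ⟨m, rfl⟩ := M.augMk_surjective n
    rw [unitInv_btmul, unitMap_op_smul, unitMap_antipodeProj, op_smul_btmul, one_mul]

end HopfMod

theorem isEquivalence_of_isHopfAlgebroid (h : B.IsHopfAlgebroid) :
    (comparisonFunctor B).IsEquivalence where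
  faithful := comparisonFunctor_faithful B
  full := comparisonFunctor_full B
  essSurj := by
    obtain ⟨S⟩ := h
    refine ⟨fun M => ⟨ModuleCat.of R M.AugQuotient, ⟨(HopfMod.isoOfBijective M.unitHom ?_).symm⟩⟩⟩
    exact Function.bijective_iff_has_inverse.2
      ⟨M.unitInv S, HopfMod.unitInv_unitMap S, HopfMod.unitMap_unitInv S⟩

end AntipodeToEquivalence

/-! ### The implication (ii) ⇒ (i): the antipode from the inverse of ς. -/

section VarsigmaToAntipode

variable (B) in
/-- The comodule `A` with coaction the comultiplication. -/
def regularComod : Comod B where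
  carrier := A
  coact := B.comul
  coassoc := B.coassoc
  counit := B.counit_right

variable (B) in
/-- The coaction `x • a ↦ (x • a₁) • a₂` of `X • A`. -/
def cofreeCoact (X : Type u) [AddCommGroup X] [Module (Env k R) X] :
    BTensor k R X A →ₗ[Env k R] BTensor k R (BTensor k R X A) A :=
  (bassoc k R X A A).symm.toLinearMap ∘ₗ bmap k R LinearMap.id B.comul

theorem cofreeCoact_btmul {X : Type u} [AddCommGroup X] [Module (Env k R) X] (x : X) (a : A) :
    cofreeCoact B X (btmul k R x a) = (bassoc k R X A A).symm (btmul k R x (B.comul a)) := rfl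

variable (B) in
/-- The cofree comodule `X • A`. -/
def cofreeComod (X : Type u) [AddCommGroup X] [Module (Env k R) X] : Comod B where
  carrier := BTensor k R X A
  coact := cofreeCoact B X
  coassoc y := by
    induction y using btensor_induction with
    | zero => simp
    | add x y hx hy => simp only [map_add, hx, hy]
    | tmul x a =>
      have h1 : ∀ y : BTensor k R A A,
          bassoc k R (BTensor k R X A) A A (bmap k R (cofreeCoact B X) LinearMap.id
              ((bassoc k R X A A).symm (btmul k R x y)))
          = (bassoc k R X A (BTensor k R A A)).symm (btmul k R x
              (bassoc k R A A A (bmap k R B.comul LinearMap.id y))) := by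
        intro y
        induction y using btensor_induction with
        | zero => simp [btmul_zero]
        | add x y hx hy => simp only [map_add, btmul_add, hx, hy]
        | tmul b c =>
          rw [bassoc_symm_btmul, bmap_btmul, bmap_btmul, cofreeCoact_btmul]
          generalize B.comul b = z
          induction z using btensor_induction with
          | zero => simp [btmul_zero, zero_btmul]
          | add x y hx hy => simp only [map_add, btmul_add, add_btmul, hx, hy]
          | tmul d e => rfl
      have h2 : ∀ y : BTensor k R A A,
          bmap k R LinearMap.id B.comul ((bassoc k R X A A).symm (btmul k R x y))
          = (bassoc k R X A (BTensor k R A A)).symm (btmul k R x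
              (bmap k R LinearMap.id B.comul y)) := by
        intro y
        induction y using btensor_induction with
        | zero => simp [btmul_zero]
        | add x y hx hy => simp only [map_add, btmul_add, hx, hy]
        | tmul b c => rfl
      rw [cofreeCoact_btmul, h1, h2, B.coassoc]
  counit y := by
    induction y using btensor_induction with
    | zero => simp
    | add x y hx hy => simp only [map_add, hx, hy]
    | tmul x a =>
      have h : ∀ y : BTensor k R A A, brunit k R (BTensor k R X A)
          (bmap k R LinearMap.id B.counit ((bassoc k R X A A).symm (btmul k R x y)))
          = btmul k R x (brunit k R A (bmap k R LinearMap.id B.counit y)) := by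
        intro y
        induction y using btensor_induction with
        | zero => simp [btmul_zero]
        | add x y hx hy => simp only [map_add, btmul_add, hx, hy]
        | tmul b c =>
          rw [bassoc_symm_btmul, bmap_btmul, bmap_btmul, B.counit_eq, brunit_btmul, brunit_btmul]
          exact one_tmul_smul_btmul k R _ x b
      rw [cofreeCoact_btmul, h, B.counit_right]

variable (B) in
/-- The comultiplication as a morphism of comodules `A → A • A`. -/
def comulHom : regularComod B ⟶ cofreeComod B A :=
  Comod.Hom.mk (Q := regularComod B) (Q₂ := cofreeComod B A) B.comul fun a =>
    (congrArg (bassoc k R A A A).symm (B.coassoc a).symm).trans (LinearEquiv.symm_apply_apply _ _)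

variable (B) in
/-- The morphism `f • A : X • A → Y • A` of cofree comodules. -/
def cofreeHom {X Y : Type u} [AddCommGroup X] [Module (Env k R) X] [AddCommGroup Y]
    [Module (Env k R) Y] (f : X →ₗ[Env k R] Y) : cofreeComod B X ⟶ cofreeComod B Y :=
  Comod.Hom.mk (Q := cofreeComod B X) (Q₂ := cofreeComod B Y) (bmap k R f LinearMap.id) fun q => by
    change cofreeCoact B Y (bmap k R f LinearMap.id q)
      = bmap k R (bmap k R f LinearMap.id) LinearMap.id (cofreeCoact B X q)
    change BTensor k R X A at q
    induction q using btensor_induction with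
    | zero => simp
    | add x y hx hy => simp only [map_add, hx, hy]
    | tmul x a =>
      rw [bmap_btmul, cofreeCoact_btmul, cofreeCoact_btmul]
      change (bassoc k R Y A A).symm (btmul k R (f x) (B.comul a)) = _
      generalize B.comul a = y
      induction y using btensor_induction with
      | zero => simp [btmul_zero]
      | add x y hx hy => simp only [map_add, btmul_add, hx, hy]
      | tmul b c => rfl

theorem varsigmaMap_naturality {Q Q₂ : Comod B} (f : Q ⟶ Q₂) (x : Q.carrier ⊗[Env k R] A) :
    varsigmaMap Q₂ (TensorProduct.map (Comod.Hom.hom f) LinearMap.id x)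
      = bmap k R (TensorProduct.map (Comod.Hom.hom f) LinearMap.id) LinearMap.id
          (varsigmaMap Q x) :=
  congrArg (fun g => g.hom x) ((varsigma B).naturality f)

/-- Right `A`-linearity of ς_Q; because of it the inverse is governed by its values at (q ∘ 1) • 1,
the translation map. -/
theorem varsigmaMap_op_smul (Q : Comod B) (b : A) (x : Q.carrier ⊗[Env k R] A) :
    varsigmaMap Q (op b • x)
      = bmap k R LinearMap.id (LinearMap.mulRight (Env k R) b) (varsigmaMap Q x) := by
  induction x using TensorProduct.induction_on with
  | zero => simp
  | add x y hx hy => simp only [smul_add, map_add, hx, hy]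
  | tmul q a =>
    rw [op_smul_circ_tmul, varsigmaMap_tmul, varsigmaMap_tmul, bmap_bmap, LinearMap.mulRight_mul]
    rfl

section Translation

variable (h : ∀ Q : Comod B, Function.Bijective (varsigmaMap Q))

/-- The inverse of `ς_Q`. -/
def varsigmaInv (Q : Comod B) :
    BTensor k R (Q.carrier ⊗[Env k R] J k R) A →ₗ[Env k R] Q.carrier ⊗[Env k R] A :=
  (LinearEquiv.ofBijective (varsigmaMap Q) (h Q)).symm.toLinearMap

theorem varsigmaMap_varsigmaInv (Q : Comod B) (x : BTensor k R (Q.carrier ⊗[Env k R] J k R) A) :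
    varsigmaMap Q (varsigmaInv h Q x) = x :=
  (LinearEquiv.ofBijective (varsigmaMap Q) (h Q)).apply_symm_apply x

/-- The map `q ↦ q ∘ 1 : Q → Q ∘ J`. -/
def circUnitMk (k : Type v) (R Q : Type u) [CommRing k] [CommRing R] [Algebra k R] [AddCommGroup Q]
    [Module (Env k R) Q] : Q →ₗ[Env k R] Q ⊗[Env k R] J k R :=
  (TensorProduct.mk (Env k R) Q (J k R)).flip (diagEquiv k R R 1)

/-- The translation map `q ↦ ς⁻¹((q ∘ 1) • 1)`. -/
def translation (Q : Comod B) : Q.carrier →+ Q.carrier ⊗[Env k R] A :=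
  AddMonoidHom.mk' (fun q => varsigmaInv h Q (btmul k R (circUnitMk k R Q.carrier q) 1))
    (fun p q => by rw [map_add, add_btmul, map_add])

theorem varsigmaMap_translation (Q : Comod B) (q : Q.carrier) :
    varsigmaMap Q (translation h Q q) = btmul k R (circUnitMk k R Q.carrier q) 1 :=
  varsigmaMap_varsigmaInv h Q _

theorem varsigmaInv_btmul (Q : Comod B) (q : Q.carrier) (a : A) :
    varsigmaInv h Q (btmul k R (circUnitMk k R Q.carrier q) a) = op a • translation h Q q := by
  apply (h Q).1
  rw [varsigmaMap_varsigmaInv, varsigmaMap_op_smul, varsigmaMap_translation, bmap_btmul,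
    LinearMap.mulRight_apply, one_mul, LinearMap.id_apply]

theorem translation_naturality {Q Q₂ : Comod B} (f : Q ⟶ Q₂) (q : Q.carrier) :
    translation h Q₂ (Comod.Hom.hom f q)
      = TensorProduct.map (Comod.Hom.hom f) LinearMap.id (translation h Q q) := by
  apply (h Q₂).1
  rw [varsigmaMap_translation, varsigmaMap_naturality, varsigmaMap_translation, bmap_btmul]
  rfl

theorem translation_one_tmul_smul (Q : Comod B) (r : R) (q : Q.carrier) :
    translation h Q (((1 : R) ⊗ₜ[k] r) • q) = op (src k R A r) • translation h Q q := by
  rw [← varsigmaInv_btmul]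
  change varsigmaInv h Q (btmul k R (circUnitMk k R Q.carrier (((1 : R) ⊗ₜ[k] r) • q)) 1) = _
  rw [map_smul, btmul_balanced, tmul_one_smul_eq, mul_one]

/-- This inverts ς_Q(q ∘ 1) = (q₀ ∘ 1) • q₁; for q = 1 • a in A • A it becomes the identity for
S(a₁) a₂. -/
theorem varsigmaInv_coact (Q : Comod B) (q : Q.carrier) :
    varsigmaInv h Q (bmap k R (circUnitMk k R Q.carrier) LinearMap.id (Q.coact q))
      = q ⊗ₜ[Env k R] (1 : A) := by
  apply (h Q).1
  rw [varsigmaMap_varsigmaInv, varsigmaMap_tmul, LinearMap.mulRight_one]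
  rfl

variable (B) in
/-- The map `(A • A) ∘ A → A`, `(c • d) ∘ b ↦ c t(ε(d)) b`. -/
def counitFold : BTensor k R A A ⊗[Env k R] A →ₗ[Env k R] A :=
  LinearMap.mul' (Env k R) A ∘ₗ TensorProduct.map (counitMap B A) LinearMap.id

theorem counitFold_tmul (x : BTensor k R A A) (b : A) :
    counitFold B (x ⊗ₜ[Env k R] b) = counitMap B A x * b := rfl

theorem counitFold_op_smul (b : A) (x : BTensor k R A A ⊗[Env k R] A) :
    counitFold B (LinearMap.lTensor _ (LinearMap.mulRight (Env k R) b) x)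
      = counitFold B x * b := by
  induction x using TensorProduct.induction_on with
  | zero => simp
  | add x y hx hy => simp only [map_add, add_mul, hx, hy]
  | tmul x a => exact (mul_assoc _ _ _).symm

/-- The map `A • A → A` which sends `c • d` to `c S(d)`, for the antipode `S`. -/
def translationFold : BTensor k R A A →+ A :=
  (counitFold B).toAddMonoidHom.comp (translation h (cofreeComod B A))

theorem translationFold_apply (x : BTensor k R A A) :
    translationFold h x = counitFold B (translation h (cofreeComod B A) x) := rfl

theorem translationFold_one_tmul_smul (r : R) (x : BTensor k R A A) :
    translationFold h (((1 : R) ⊗ₜ[k] r) • x) = translationFold h x * src k R A r :=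
  (congrArg (counitFold B) (translation_one_tmul_smul h (cofreeComod B A) r x)).trans
    (counitFold_op_smul _ _)

/-- Left multiplication by c is a bimodule endomorphism of `A`, so it induces a comodule
endomorphism of the cofree comodule A • A, along which the translation map is natural. -/
theorem translationFold_bmap_mulLeft (c : A) (x : BTensor k R A A) :
    translationFold h (bmap k R (LinearMap.mulLeft (Env k R) c) LinearMap.id x)
      = c * translationFold h x := by
  refine (congrArg (counitFold B) (translation_naturality h
    (cofreeHom B (LinearMap.mulLeft (Env k R) c)) x)).trans ?_
  rw [translationFold_apply]
  change counitFold B (TensorProduct.map (bmap k R (LinearMap.mulLeft (Env k R) c) LinearMap.id)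
    LinearMap.id (translation h (cofreeComod B A) x)) = _
  generalize translation h (cofreeComod B A) x = y
  change BTensor k R A A ⊗[Env k R] A at y
  induction y using TensorProduct.induction_on with
  | zero => simp
  | add x y hx hy => simp only [map_add, mul_add, hx, hy]
  | tmul x a =>
    rw [TensorProduct.map_tmul, counitFold_tmul, counitFold_tmul, ← mul_assoc]
    congr 1
    induction x using btensor_induction with
    | zero => simp
    | add x y hx hy => simp only [map_add, mul_add, hx, hy]
    | tmul b d =>
      rw [bmap_btmul, counitMap_btmul, counitMap_btmul, LinearMap.mulLeft_apply, mul_smul_comm]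
      rfl

/-- Hence the fold has the form c • d ↦ c S(d), with S(d) its value at 1 • d. -/
theorem translationFold_btmul (c d : A) :
    translationFold h (btmul k R c d) = c * translationFold h (btmul k R 1 d) := by
  rw [← translationFold_bmap_mulLeft, bmap_btmul, LinearMap.mulLeft_apply, mul_one]
  rfl

theorem translationFold_src_mul (r : R) (d : A) :
    translationFold h (btmul k R 1 (src k R A r * d))
      = tgt k R A r * translationFold h (btmul k R 1 d) := by
  rw [← tmul_one_smul_eq, ← btmul_balanced, translationFold_btmul, one_tmul_smul_eq, mul_one]

theorem translationFold_tgt_mul (r : R) (d : A) :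
    translationFold h (btmul k R 1 (tgt k R A r * d))
      = translationFold h (btmul k R 1 d) * src k R A r := by
  rw [← one_tmul_smul_eq, ← one_tmul_smul_btmul, translationFold_one_tmul_smul]

/-- Naturality along the comodule map Δ : A → A • A reduces the claim to ς⁻¹ for the regular
comodule `A`, where the fold becomes the multiplication of `A`. -/
theorem translationFold_comul (a : A) :
    translationFold h (B.comul a) = src k R A (B.eps a) := by
  refine (congrArg (counitFold B) (translation_naturality h (comulHom B) a)).trans ?_
  -- Chosen so that ν ς is the multiplication of `A`: it sends c ∘ b to s(ε(c₁)) c₂ b = c b. Thus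
  -- the value sought is ν((a ∘ 1) • 1) = s(ε(a)).
  let ν : BTensor k R (A ⊗[Env k R] J k R) A →ₗ[Env k R] A :=
    (blunit k R A).toLinearMap ∘ₗ bmap k R (circUnitLift B.counit) LinearMap.id
  have hν : ∀ (c b : A), ν (btmul k R (circUnitMk k R A c) b) = src k R A (B.eps c) * b :=
    fun c b => by
      change blunit k R A (btmul k R
        (circUnitLift B.counit (c ⊗ₜ[Env k R] diagEquiv k R R 1)) b) = _
      rw [circUnitLift_tmul, ← Algebra.TensorProduct.one_def, one_smul, B.counit_eq, blunit_btmul,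
        tmul_one_smul_eq]
  have h1 : ∀ x : A ⊗[Env k R] A,
      counitFold B (TensorProduct.map B.comul LinearMap.id x)
        = ν (varsigmaMap (regularComod B) x) := by
    intro x
    induction x using TensorProduct.induction_on with
    | zero => exact (map_zero _).trans (map_zero (ν ∘ₗ varsigmaMap (regularComod B))).symm
    | add x y hx hy =>
      rw [map_add, map_add, hx, hy]
      exact (map_add (ν ∘ₗ varsigmaMap (regularComod B)) x y).symm
    | tmul c b =>
      rw [TensorProduct.map_tmul, counitFold_tmul]
      refine (congrArg (· * b) (B.counit_right c)).trans (Eq.symm ?_)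
      refine (congrArg ν (varsigmaMap_tmul (regularComod B) c b)).trans ?_
      change ν (bmap k R (circUnitMk k R A) (LinearMap.mulRight (Env k R) b) (B.comul c)) = _
      have h2 : ∀ y : BTensor k R A A,
          ν (bmap k R (circUnitMk k R A) (LinearMap.mulRight (Env k R) b) y)
            = blunit k R A (bmap k R B.counit LinearMap.id y) * b := by
        intro y
        induction y using btensor_induction with
        | zero => simp
        | add x y hx hy => simp only [map_add, add_mul, hx, hy]
        | tmul d e =>
          rw [bmap_btmul, hν, bmap_btmul, B.counit_eq, blunit_btmul, tmul_one_smul_eq, mul_assoc]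
          rfl
      rw [h2, B.counit_left]
  refine (h1 _).trans ((congrArg ν (varsigmaMap_translation h (regularComod B) a)).trans ?_)
  exact (hν a 1).trans (mul_one _)

/-- For x = c • d, right `A`-linearity of ς⁻¹ and of the fold pulls d out of ((1 • c) ∘ 1) • d,
leaving S(c) d. -/
theorem counitFold_varsigmaInv (S : A →+ A)
    (hS : ∀ a r, S (tgt k R A r * a) = S a * src k R A r)
    (hS' : ∀ d, S d = translationFold h (btmul k R 1 d)) (x : BTensor k R A A) :
    counitFold B (varsigmaInv h (cofreeComod B A)
        (bmap k R (circUnitMk k R (BTensor k R A A)) LinearMap.id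
          ((bassoc k R A A A).symm (btmul k R 1 x))))
      = antipodeMul S hS x := by
  let F : BTensor k R (BTensor k R A A ⊗[Env k R] J k R) A →ₗ[Env k R] A :=
    counitFold B ∘ₗ varsigmaInv h (cofreeComod B A)
  change F _ = _
  induction x using btensor_induction with
  | zero => simp [btmul_zero]
  | add x y hx hy => simp only [btmul_add, map_add, hx, hy]
  | tmul c d =>
    rw [antipodeMul_btmul, hS']
    exact (congrArg (counitFold B) (varsigmaInv_btmul h (cofreeComod B A) (btmul k R 1 c) d)).trans
      (counitFold_op_smul d _)

/-- The antipode obtained from the invertibility of `ς`. -/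
def antipodeOfVarsigma [Algebra k A] [IsScalarTower k (Env k R) A] : Antipode B where
  map :=
    { toFun := fun a => translationFold h (btmul k R 1 a)
      map_add' := fun a b => by rw [btmul_add, map_add]
      map_smul' := fun c a => by
        -- Scalars from k act through s and equally through t, as c ⊗ 1 = 1 ⊗ c in R ⊗ R; so S(s(r)
        -- a) = t(r) S(a) yields k-linearity.
        have hs : ∀ b : A, c • b = src k R A (algebraMap k R c) * b := fun b => by
          rw [← tmul_one_smul_eq, ← algebraMap_smul (Env k R) c b]
          rfl
        have ht : ∀ b : A, c • b = tgt k R A (algebraMap k R c) * b := fun b => by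
          rw [← one_tmul_smul_eq, ← algebraMap_smul (Env k R) c b]
          congr 1
          rw [Algebra.TensorProduct.algebraMap_apply, Algebra.algebraMap_eq_smul_one,
            TensorProduct.smul_tmul]
        rw [RingHom.id_apply, hs a, translationFold_src_mul, ht] }
  map_mul_src a r := by
    rw [← src_comm]
    exact translationFold_src_mul h r a
  map_tgt_mul a r := translationFold_tgt_mul h r a
  mul_map a := by
    refine Eq.trans ?_ (translationFold_comul h a)
    generalize B.comul a = x
    induction x using btensor_induction with
    | zero => simp
    | add x y hx hy => simp only [map_add, hx, hy]
    | tmul c d => exact (translationFold_btmul h c d).symm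
  map_mul a := by
    -- Folding both sides of ς⁻¹(((1 • a₁) ∘ 1) • a₂) = (1 • a) ∘ 1 gives S(a₁) a₂ on the left and
    -- t(ε(a)) on the right.
    have h1 := varsigmaInv_coact h (cofreeComod B A) (btmul k R 1 a)
    have h2 : counitFold B (btmul k R 1 a ⊗ₜ[Env k R] (1 : A)) = tgt k R A (B.eps a) := by
      rw [counitFold_tmul, counitMap_btmul, one_tmul_smul_eq, mul_one, mul_one]
    exact (counitFold_varsigmaInv h _ _ (fun d => rfl) (B.comul a)).symm.trans
      ((congrArg (counitFold B) h1).trans h2)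

end Translation

end VarsigmaToAntipode

end Bimod

end

theorem corollary4p10 {k : Type v} {R A : Type u} [CommRing k] [CommRing R] [Algebra k R]
    [Ring A] [Algebra k A] [Algebra (R ⊗[k] R) A] [IsScalarTower k (R ⊗[k] R) A]
    (B : Bimod.Bialgebroid k R A) :
    List.TFAE [B.IsHopfAlgebroid,
      CategoryTheory.IsIso (Bimod.varsigma B),
      (Bimod.comparisonFunctor B).IsEquivalence] := by
  tfae_have 1 → 3 := Bimod.isEquivalence_of_isHopfAlgebroid
  tfae_have 3 → 2 := Bimod.isIso_varsigma_of_isEquivalence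
  tfae_have 2 → 1 := fun h => ⟨Bimod.antipodeOfVarsigma ((Bimod.isIso_varsigma_iff B).1 h)⟩
  tfae_finish
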